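/- Setting. Let $\|\cdot\|$ be an arbitrary norm on $\mathbb{R}^d$ with dual norm $\|g\|_*=\sup_{\|w\|\le 1}\langle g,w\rangle$. Let $\mathcal{X}\subseteq\mathbb{R}^d$ be non-empty, closed and convex, let $f:\mathcal{X}\to\mathbb{R}$ be convex with a minimizer $x^*\in\mathcal{X}$, and put $f^*=f(x^*)$ and $\partial f(x)=\{g: f(y)\ge f(x)+\langle g,y-x\rangle\ \forall y\in\mathcal{X}\}$. Let $\psi:\mathbb{R}^d\to(-\infty,+\infty]$ be closed and convex with $\mathcal{X}\subseteq\mathrm{dom}(\psi)$ and $\mathrm{int}(\mathrm{dom}(\psi))\ne\emptyset$, differentiable on $\mathrm{int}(\mathrm{dom}(\psi))$, and $1$-strongly convex with respect to $\|\cdot\|$, that is, $\psi(x)\ge\psi(y)+\langle x-y,g\rangle+\frac12\|x-y\|^2$ for all $x,y\in\mathrm{dom}(\psi)$ and $g\in\partial\psi(y)$. Assume also that $\mathcal{X}\subseteq\mathrm{int}(\mathrm{dom}(\psi))$, or that $\|\nabla\psi(y_n)\|_2\to\infty$ for every sequence $(y_n)$ in $\mathrm{int}(\mathrm{dom}(\psi))$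 converging to a point of the boundary of $\mathrm{dom}(\psi)$. Write $B(x,y)=\psi(x)-\psi(y)-\langle x-y,\nabla\psi(y)\rangle$. Algorithm. Fix $x_1\in\mathcal{X}\cap\mathrm{int}(\mathrm{dom}(\psi))$ and step sizes $\eta_t>0$. For $t\ge1$ the oracle returns $\hat g_t=g_t-\xi_t$ with $g_t\in\partial f(x_t)$, and $$x_{t+1}=\arg\min_{x\in\mathcal{X}}\ \langle\hat g_t,x\rangle+\tfrac1{\eta_t}B(x,x_t).$$ Let $\mathcal{F}_t=\sigma(\xi_1,\dots,\xi_t)$. The subgradient $g_t$ is $\mathcal{F}_t$-measurable and satisfies $\|g_t\|_*\le G$ for a constant $G>0$. For some $p>4$ and $\phi>0$ the random vectors $\xi_t$ satisfy, for every $t\ge1$, $\mathbb{E}[\xi_t\mid\mathcal{F}_{t-1}]=0$ and $\mathbb{E}[(\|\xi_t\|_*/\phi)^p\mid\mathcal{F}_{t-1}]\le1$ almost surely. Let $\bar x_T=\frac1T\sum_{t=1}^Tx_t$. Claim. There is a constant $C>0$ depending only on $p$ such that for every $\delta\in(0,1)$, $\eta>0$ and integer $T\ge1$, each of the following holds. (i)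 If $\eta_t=\eta$ for all $t$, then with probability at least $1-\delta$, $$f(\bar x_T)-f^*\le\frac CT\left(\frac{B(x^*,x_1)}{\eta}+\eta\big(G^2+\phi^2\log(e/\delta)\big)T+\eta\phi^2(T/\delta)^{2/p}\right).$$ (ii) If $\eta_t=\eta/\sqrt t$ for all $t$, then with probability at least $1-\delta$, $$f(\bar x_T)-f^*\le\frac{C\log(eT)}{\sqrt T}\left(\frac{B(x^*,x_1)}{\eta}+\eta\big(G^2+\phi^2(1/\delta)^{2/p}\big)\right).$$ -/

import Mathlib

open MeasureTheory Filter Topology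

universe u v

/-- The subdifferential at `x` of the function that equals `h` on `D` and `+∞` outside `D`.
Dual vectors are continuous linear functionals, so `v (y - x)` is the pairing `⟨v, y - x⟩`. -/
def subdifferential {E : Type u} [NormedAddCommGroup E] [NormedSpace ℝ E]
    (D : Set E) (h : E → ℝ) (x : E) : Set (StrongDual ℝ E) :=
  {v | x ∈ D ∧ ∀ y ∈ D, h x + v (y - x) ≤ h y}

/-- The Bregman divergence of `x` from `y` induced by `ψ`. -/
noncomputable def bregman {E : Type u} [NormedAddCommGroup E] [NormedSpace ℝ E]
    (ψ : E → ℝ) (x y : E) : ℝ :=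
  ψ x - ψ y - fderiv ℝ ψ y (x - y)

/-- The standing assumption on the regularizer. The extended-valued convex function
`E → (-∞, +∞]` is given by its effective domain `dom` and its (finite) values `ψ` there. -/
structure IsRegularizer {E : Type u} [NormedAddCommGroup E] [NormedSpace ℝ E]
    (X dom : Set E) (ψ : E → ℝ) : Prop where
  convexOn : ConvexOn ℝ dom ψ
  /-- the epigraph is closed -/
  closed : IsClosed {q : E × ℝ | q.1 ∈ dom ∧ ψ q.1 ≤ q.2}
  differentiable : ∀ y ∈ interior dom, DifferentiableAt ℝ ψ y
  /-- 1-strong convexity with respect to the norm of `E` -/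
  stronglyConvex : ∀ x ∈ dom, ∀ y ∈ dom, ∀ v ∈ subdifferential dom ψ y,
    ψ y + v (x - y) + (1 / 2) * ‖x - y‖ ^ 2 ≤ ψ x
  subset_dom : X ⊆ dom
  interior_nonempty : (interior dom).Nonempty
  /-- either the gradient blows up at the boundary of `dom`, or `X` lies in its interior -/
  boundary :
    (∀ (y : ℕ → E) (z : E), (∀ n, y n ∈ interior dom) → z ∈ frontier dom →
      Tendsto y atTop (𝓝 z) → Tendsto (fun n => ‖fderiv ℝ ψ (y n)‖) atTop atTop)
    ∨ X ⊆ interior dom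

/-- The sigma-algebra generated by the first `t` noise vectors `ξ 1, …, ξ t`. -/
noncomputable abbrev noiseSigma {E : Type u} [NormedAddCommGroup E] [NormedSpace ℝ E] {Ω : Type v}
    (ξ : ℕ → Ω → StrongDual ℝ E) (t : ℕ) : MeasurableSpace Ω :=
  ⨆ s ∈ Set.Icc 1 t, MeasurableSpace.comap (ξ s) inferInstance

/-- The noise `ξ 1, ξ 2, …` is conditionally centered given its past, and the conditional
`p`-th moment of its dual norm is at most `φ ^ p`. (The integrability field is part of the
moment bound; without it the conditional expectation would have a default value.) -/
structure IsPolyNoise {E : Type u} [NormedAddCommGroup E] [NormedSpace ℝ E]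
    {Ω : Type v} [MeasurableSpace Ω] (μ : Measure Ω)
    (ξ : ℕ → Ω → StrongDual ℝ E) (p φ : ℝ) : Prop where
  measurable : ∀ t, 1 ≤ t → Measurable (ξ t)
  centered : ∀ t, 1 ≤ t → μ[ξ t | noiseSigma ξ (t - 1)] =ᵐ[μ] 0
  integrable : ∀ t, 1 ≤ t → Integrable (fun ω => (‖ξ t ω‖ / φ) ^ p) μ
  condMoment : ∀ t, 1 ≤ t →
    μ[fun ω => (‖ξ t ω‖ / φ) ^ p | noiseSigma ξ (t - 1)] ≤ᵐ[μ] fun _ => 1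

/-- `x 1, x 2, …` are the iterates of stochastic mirror descent on `f : X → ℝ` with step sizes
`step`, started at `x₁`, when the oracle answers the query `x t` with `g t - ξ t`, where `g t` is
a subgradient of `f` at `x t`. Index `0` is not used. -/
structure IsMirrorDescent {E : Type u} [NormedAddCommGroup E] [NormedSpace ℝ E]
    {Ω : Type v} (X dom : Set E) (ψ f : E → ℝ) (step : ℕ → ℝ) (x₁ : E)
    (g ξ : ℕ → Ω → StrongDual ℝ E) (x : ℕ → Ω → E) : Prop where
  start_mem : x₁ ∈ X ∩ interior dom
  start : ∀ ω, x 1 ω = x₁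
  subgradient : ∀ t, 1 ≤ t → ∀ ω, g t ω ∈ subdifferential X f (x t ω)
  update_mem : ∀ t, 1 ≤ t → ∀ ω, x (t + 1) ω ∈ X
  update_min : ∀ t, 1 ≤ t → ∀ ω,
    IsMinOn (fun z => (g t ω - ξ t ω) z + 1 / step t * bregman ψ z (x t ω)) X (x (t + 1) ω)

/-- The average `(1 / T) ∑_{t=1}^T x t`. -/
noncomputable def avgIterate {E : Type u} [NormedAddCommGroup E] [NormedSpace ℝ E]
    {Ω : Type v} (x : ℕ → Ω → E) (T : ℕ) (ω : Ω) : E :=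
  (1 / (T : ℝ)) • ∑ t ∈ Finset.Icc 1 T, x t ω

/-!
The function `f` is controlled through the Bregman divergences `B (xstar, x t)`: convexity and
first-order optimality of the update give
`B (xstar, x (t+1)) ≤ B (xstar, x t) - η_t (f (x t) - f xstar) + η_t ⟨ξ t, x t - xstar⟩
  + η_t ^ 2 (G ^ 2 + ‖ξ t‖ ^ 2)` (`IsMirrorDescent.bregman_succ_le`). This uses that the iterates stay
in the interior of the domain, where `ψ` is differentiable
(`IsRegularizer.mem_interior_of_isMinOn`), and it reduces the claim to upper tails of two sums over
the noise.

The domain may be unbounded, so the martingale `∑ η_t ⟨ξ t, x t - xstar⟩` has no a priori bounded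
coefficients. It is replaced by its version stopped when `‖x t - xstar‖` first exceeds a radius `R`.
If the stopped sum and the sum of the squared noise norms are as small as their tails predict, the
recursion shows that `R` is never exceeded, and then it bounds the regret by `R ^ 2`
(`sum_regret_le`). Since the stopped martingale is frozen after stopping, its tail is only needed
at the terminal time. Predictability of the iterates holds because the update is a Lipschitz
function of the dual vector `η_t (g t - ξ t) - ∇ψ (x t)` (`IsMirrorDescent.measurable`).

Both tails follow from one Fuk–Nagaev inequality (`measure_lt_sum_and_forall_le_of_rpow_eq`), with
the `p`-th moment for the martingale and the `p / 2`-th moment for the squared norms. The step sizes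
are written as `η * w t` with `w t ≤ 1`; the resulting bound
(`IsMirrorDescent.measure_sum_regret_gt_le`) involves the weights through `∑ w t ^ 2` and
`∑ w t ^ p` only. For `w t = 1` both sums equal `T`. For `w t = 1 / √t` the first is at most
`log (e T)` and, as `p > 4`, the second is at most `2`, while `log (e / δ)` is dominated by
`(1 / δ) ^ (2 / p)`.
-/

/-! ### One step of mirror descent -/

section MirrorStep

variable {E : Type u} [NormedAddCommGroup E] [NormedSpace ℝ E]

theorem ConvexOn.add_fderiv_le {D : Set E} {h : E → ℝ} (hh : ConvexOn ℝ D h) {x y : E}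
    (hy : y ∈ D) (hd : DifferentiableAt ℝ h y) (hx : x ∈ D) :
    h y + fderiv ℝ h y (x - y) ≤ h x := by
  let L : ℝ →ᵃ[ℝ] E := AffineMap.lineMap y x
  have hc : ConvexOn ℝ (L ⁻¹' D) (h ∘ L) := hh.comp_affineMap L
  have h0 : L 0 = y := AffineMap.lineMap_apply_zero y x
  have h1 : L 1 = x := AffineMap.lineMap_apply_one y x
  have hL : HasDerivAt L (x - y) 0 := AffineMap.hasDerivAt_lineMap
  have hder : HasDerivAt (h ∘ L) (fderiv ℝ h y (x - y)) 0 := by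
    refine HasFDerivAt.comp_hasDerivAt (0 : ℝ) (l := h) ?_ hL
    rw [h0]; exact hd.hasFDerivAt
  have := hc.le_slope_of_hasDerivAt (x := 0) (y := 1) (by simpa [h0] using hy)
    (by simpa [h1] using hx) one_pos hder
  simp only [slope, Function.comp, h0, h1, sub_zero, inv_one, vsub_eq_sub, smul_eq_mul,
    one_mul] at this
  linarith

variable {X dom : Set E} {ψ f : E → ℝ}

theorem IsRegularizer.fderiv_mem_subdifferential (hψ : IsRegularizer X dom ψ) {y : E}
    (hy : y ∈ interior dom) : fderiv ℝ ψ y ∈ subdifferential dom ψ y :=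
  ⟨interior_subset hy, fun _ hx =>
    hψ.convexOn.add_fderiv_le (interior_subset hy) (hψ.differentiable y hy) hx⟩

theorem IsRegularizer.half_sq_norm_le_bregman (hψ : IsRegularizer X dom ψ) {x y : E}
    (hx : x ∈ dom) (hy : y ∈ interior dom) : 1 / 2 * ‖x - y‖ ^ 2 ≤ bregman ψ x y := by
  have := hψ.stronglyConvex x hx y (interior_subset hy) _ (hψ.fderiv_mem_subdifferential hy)
  unfold bregman
  linarith

/-- A minimizer of `v + B(·, y) / s` over `X` lies in the interior of the domain. If it were a
boundary point `z`, then along the segment from `z` to an interior point `x₁` of `X` the slope of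
the objective at `z` would be `-∞`, since the directional derivative of `ψ` in the direction
`x₁ - z` tends to `-∞` where the gradient blows up. -/
theorem IsRegularizer.mem_interior_of_isMinOn [FiniteDimensional ℝ E]
    (hψ : IsRegularizer X dom ψ) (hX : Convex ℝ X) {x₁ y z : E} (hx₁ : x₁ ∈ X ∩ interior dom)
    (hz : z ∈ X) {v : StrongDual ℝ E} {s : ℝ} (hs : 0 < s)
    (hmin : IsMinOn (fun z => v z + 1 / s * bregman ψ z y) X z) : z ∈ interior dom := by
  rcases hψ.boundary with hb | hb
  swap
  · exact hb hz
  by_contra hzi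
  have hzd : z ∈ dom := hψ.subset_dom hz
  have hzf : z ∈ frontier dom := ⟨subset_closure hzd, hzi⟩
  -- the points `z + l n • (x₁ - z)` of the segment approach `z` from the interior
  let l : ℕ → ℝ := fun n => 1 / ((n : ℝ) + 1)
  have hl0 : ∀ n, 0 < l n := fun n => Nat.one_div_pos_of_nat
  have hl1 : ∀ n, l n ≤ 1 := fun n => by
    have : (0 : ℝ) ≤ n := n.cast_nonneg
    simp only [l]; rw [div_le_one (by positivity)]; linarith
  have hlt : Tendsto l atTop (𝓝 0) := tendsto_one_div_add_atTop_nhds_zero_nat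
  let Y : ℕ → E := fun n => z + l n • (x₁ - z)
  have hYi : ∀ n, Y n ∈ interior dom := fun n => by
    have := hψ.convexOn.1.combo_interior_self_mem_interior hx₁.2 hzd (hl0 n)
      (sub_nonneg.2 (hl1 n)) (by ring : l n + (1 - l n) = 1)
    convert this using 1
    simp only [Y]; module
  have hYX : ∀ n, Y n ∈ X := fun n => by
    have := hX hx₁.1 hz (hl0 n).le (sub_nonneg.2 (hl1 n)) (by ring : l n + (1 - l n) = 1)
    convert this using 1
    simp only [Y]; module
  have hYt : Tendsto Y atTop (𝓝 z) := by
    have : Tendsto Y atTop (𝓝 (z + (0 : ℝ) • (x₁ - z))) :=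
      tendsto_const_nhds.add (hlt.smul_const _)
    simpa using this
  have hgrad := hb Y z hYi hzf hYt
  -- minimality bounds the directional derivatives from below
  set c : ℝ := fderiv ℝ ψ y (x₁ - z) - s * v (x₁ - z) with hc
  have hlow : ∀ n, c ≤ fderiv ℝ ψ (Y n) (x₁ - z) := fun n => by
    have h1 : v z + 1 / s * bregman ψ z y ≤ v (Y n) + 1 / s * bregman ψ (Y n) y :=
      hmin (hYX n)
    have h2 := hψ.convexOn.add_fderiv_le (interior_subset (hYi n))
      (hψ.differentiable _ (hYi n)) hzd
    have e1 : z - Y n = -(l n • (x₁ - z)) := by simp only [Y]; module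
    have e2 : Y n - y = (z - y) + l n • (x₁ - z) := by simp only [Y]; module
    have e3 : v (Y n) = v z + l n * v (x₁ - z) := by simp only [Y, map_add, map_smul, smul_eq_mul]
    rw [e1, map_neg, map_smul, smul_eq_mul] at h2
    unfold bregman at h1
    rw [e2, e3, map_add, map_smul, smul_eq_mul] at h1
    have h3 : s * (v z + 1 / s * (ψ z - ψ y - fderiv ℝ ψ y (z - y))) ≤
      s * (v z + l n * v (x₁ - z) + 1 / s * (ψ (Y n) - ψ y -
        (fderiv ℝ ψ y (z - y) + l n * fderiv ℝ ψ y (x₁ - z)))) :=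
      mul_le_mul_of_nonneg_left h1 hs.le
    rw [mul_add, mul_add, ← mul_assoc, ← mul_assoc, mul_one_div_cancel hs.ne', one_mul,
      one_mul] at h3
    have h4 : l n * c ≤ l n * fderiv ℝ ψ (Y n) (x₁ - z) := by
      rw [hc]; nlinarith
    exact le_of_mul_le_mul_left h4 (hl0 n)
  -- the same directional derivatives bound the norm of the gradient from above
  obtain ⟨r, hr, hball⟩ : ∃ r > 0, Metric.closedBall x₁ r ⊆ interior dom :=
    Metric.nhds_basis_closedBall.mem_iff.1 (isOpen_interior.mem_nhds hx₁.2)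
  obtain ⟨M, hM⟩ : ∃ M, ∀ u ∈ Metric.closedBall x₁ r, ψ u ≤ M := by
    have : ProperSpace E := FiniteDimensional.proper ℝ E
    have hcont : ContinuousOn ψ (Metric.closedBall x₁ r) := fun u hu =>
      (hψ.differentiable u (hball hu)).continuousAt.continuousWithinAt
    obtain ⟨M, hM⟩ := (isCompact_closedBall x₁ r).bddAbove_image hcont
    exact ⟨M, fun u hu => hM ⟨u, hu, rfl⟩⟩
  set m : ℝ := ψ x₁ - ‖fderiv ℝ ψ x₁‖ * ‖z - x₁‖ with hm
  have hlower : ∀ n, m ≤ ψ (Y n) := fun n => by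
    have h1 := hψ.convexOn.add_fderiv_le (interior_subset hx₁.2)
      (hψ.differentiable _ hx₁.2) (interior_subset (hYi n))
    have h2 := (fderiv ℝ ψ x₁).le_opNorm (Y n - x₁)
    have h3 : ‖Y n - x₁‖ ≤ ‖z - x₁‖ := by
      have : Y n - x₁ = (1 - l n) • (z - x₁) := by simp only [Y]; module
      rw [this, norm_smul, Real.norm_of_nonneg (sub_nonneg.2 (hl1 n))]
      exact mul_le_of_le_one_left (norm_nonneg _) (by linarith [hl0 n])
    have h4 := mul_le_mul_of_nonneg_left h3 (norm_nonneg (fderiv ℝ ψ x₁))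
    have h5 := (abs_le.1 (Real.norm_eq_abs _ ▸ h2)).1
    rw [hm]; linarith
  set K : ℝ := (M - m + |c|) / r with hK
  have hbound : ∀ n, ‖fderiv ℝ ψ (Y n)‖ ≤ K := fun n => by
    have key : ∀ w : E, ‖w‖ ≤ r → fderiv ℝ ψ (Y n) w ≤ M - m + |c| := fun w hw => by
      have hmem : x₁ + w ∈ Metric.closedBall x₁ r := by simpa using hw
      have h1 := hψ.convexOn.add_fderiv_le (interior_subset (hYi n))
        (hψ.differentiable _ (hYi n)) (interior_subset (hball hmem))
      have e : x₁ + w - Y n = w + (1 - l n) • (x₁ - z) := by simp only [Y]; module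
      rw [e, map_add, map_smul, smul_eq_mul] at h1
      have h2 := hM _ hmem
      have h3 := hlower n
      have h4 : -|c| ≤ (1 - l n) * fderiv ℝ ψ (Y n) (x₁ - z) := by
        have h5 : (1 - l n) * c ≤ (1 - l n) * fderiv ℝ ψ (Y n) (x₁ - z) :=
          mul_le_mul_of_nonneg_left (hlow n) (sub_nonneg.2 (hl1 n))
        have h6 : (1 - l n) * -|c| ≤ (1 - l n) * c :=
          mul_le_mul_of_nonneg_left (neg_abs_le c) (sub_nonneg.2 (hl1 n))
        nlinarith [hl0 n, abs_nonneg c]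
      linarith
    have hK0 : 0 ≤ M - m + |c| := by simpa using key 0 (by simpa using hr.le)
    have hscale : ∀ w : E, w ≠ 0 → fderiv ℝ ψ (Y n) w ≤ K * ‖w‖ := fun w hw => by
      have hw0 : 0 < ‖w‖ := norm_pos_iff.2 hw
      have h1 := key ((r / ‖w‖) • w) (by
        rw [norm_smul, Real.norm_of_nonneg (by positivity), div_mul_cancel₀ _ hw0.ne'])
      rw [map_smul, smul_eq_mul, div_mul_eq_mul_div, div_le_iff₀ hw0] at h1
      rw [hK, div_mul_eq_mul_div, le_div_iff₀ hr]
      linarith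
    refine ContinuousLinearMap.opNorm_le_bound _ (div_nonneg hK0 hr.le) fun w => ?_
    rcases eq_or_ne w 0 with rfl | hw
    · simp
    · have h1 := hscale (-w) (neg_ne_zero.2 hw)
      rw [map_neg, norm_neg] at h1
      exact abs_le.2 ⟨by linarith, hscale w hw⟩
  obtain ⟨n, hn⟩ := (hgrad.eventually_gt_atTop K).exists
  exact absurd (hbound n) (not_le.2 hn)

theorem IsRegularizer.first_order_optimality (hψ : IsRegularizer X dom ψ) (hX : Convex ℝ X)
    {y z x : E} (hz : z ∈ X) (hzi : z ∈ interior dom) (hx : x ∈ X) {v : StrongDual ℝ E} {s : ℝ}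
    (hs : 0 < s) (hmin : IsMinOn (fun z => v z + 1 / s * bregman ψ z y) X z) :
    0 ≤ s * v (x - z) + fderiv ℝ ψ z (x - z) - fderiv ℝ ψ y (x - z) := by
  have hd : HasFDerivAt (fun z => v z + 1 / s * bregman ψ z y)
      (v + (1 / s) • (fderiv ℝ ψ z - fderiv ℝ ψ y)) z := by
    refine v.hasFDerivAt.add (HasFDerivAt.const_mul ?_ _)
    unfold bregman
    refine ((hψ.differentiable z hzi).hasFDerivAt.sub_const _).sub ?_
    exact (fderiv ℝ ψ y).hasFDerivAt.comp z ((hasFDerivAt_id z).sub_const y)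
  have := hmin.localize.hasFDerivWithinAt_nonneg hd.hasFDerivWithinAt
    (sub_mem_posTangentConeAt_of_segment_subset (hX.segment_subset hz hx))
  simp only [_root_.add_apply, _root_.smul_apply,
    _root_.sub_apply, smul_eq_mul] at this
  have h2 := mul_nonneg hs.le this
  rw [mul_add, ← mul_assoc, mul_one_div_cancel hs.ne', one_mul] at h2
  linarith

/-- The one-step inequality of mirror descent: the three-point identity, first-order optimality, and
strong convexity, which absorbs the displacement `z - y` into `B (z, y)`. -/
theorem IsRegularizer.bregman_step_le (hψ : IsRegularizer X dom ψ) (hX : Convex ℝ X)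
    {y z x : E} (hy : y ∈ interior dom) (hz : z ∈ X) (hzi : z ∈ interior dom) (hx : x ∈ X)
    {v : StrongDual ℝ E} {s : ℝ} (hs : 0 < s)
    (hmin : IsMinOn (fun z => v z + 1 / s * bregman ψ z y) X z) :
    bregman ψ x z ≤ bregman ψ x y - s * v (y - x) + s ^ 2 / 2 * ‖v‖ ^ 2 := by
  have h1 := hψ.first_order_optimality hX hz hzi hx hs hmin
  have h2 := hψ.half_sq_norm_le_bregman (interior_subset hzi) hy
  have h3 : s * v (y - z) ≤ s ^ 2 / 2 * ‖v‖ ^ 2 + 1 / 2 * ‖z - y‖ ^ 2 := by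
    have h4 : v (y - z) ≤ ‖v‖ * ‖z - y‖ := by
      rw [norm_sub_rev]
      exact (le_abs_self _).trans (v.le_opNorm _)
    nlinarith [mul_le_mul_of_nonneg_left h4 hs.le, sq_nonneg (s * ‖v‖ - ‖z - y‖)]
  unfold bregman at *
  have e1 : x - z = (x - y) - (z - y) := by abel
  have e2 : s * v (x - z) = s * v (y - z) - s * v (y - x) := by
    rw [← mul_sub, ← map_sub]; congr 2; abel
  have e3 : fderiv ℝ ψ y (x - z) = fderiv ℝ ψ y (x - y) - fderiv ℝ ψ y (z - y) := by
    rw [← map_sub, ← e1]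
  linarith

/-- The update depends on the previous iterate `y` and the oracle answer `v` only through the dual
vector `s • v - ∇ψ y`, and it does so in a nonexpansive way. -/
theorem IsRegularizer.norm_update_sub_le (hψ : IsRegularizer X dom ψ) (hX : Convex ℝ X)
    {y z y' z' : E} (hz : z ∈ X) (hzi : z ∈ interior dom) (hz' : z' ∈ X)
    (hzi' : z' ∈ interior dom) {v v' : StrongDual ℝ E} {s : ℝ} (hs : 0 < s)
    (hmin : IsMinOn (fun z => v z + 1 / s * bregman ψ z y) X z)
    (hmin' : IsMinOn (fun z => v' z + 1 / s * bregman ψ z y') X z') :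
    ‖z - z'‖ ≤ ‖(s • v - fderiv ℝ ψ y) - (s • v' - fderiv ℝ ψ y')‖ := by
  have h1 := hψ.first_order_optimality hX hz hzi hz' hs hmin
  have h2 := hψ.first_order_optimality hX hz' hzi' hz hs hmin'
  have h3 := hψ.half_sq_norm_le_bregman (interior_subset hzi) hzi'
  have h4 := hψ.half_sq_norm_le_bregman (interior_subset hzi') hzi
  unfold bregman at h3 h4
  rw [norm_sub_rev z' z] at h4
  set W := (s • v - fderiv ℝ ψ y) - (s • v' - fderiv ℝ ψ y') with hW
  have h5 : W (z' - z) ≤ ‖W‖ * ‖z - z'‖ := by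
    rw [norm_sub_rev z z']
    exact (le_abs_self _).trans (W.le_opNorm _)
  have h6 : W (z' - z) = s * v (z' - z) - fderiv ℝ ψ y (z' - z)
      - (s * v' (z' - z) - fderiv ℝ ψ y' (z' - z)) := by
    simp [hW]
  have e : z - z' = -(z' - z) := by abel
  rw [e, map_neg, map_neg, map_neg] at h2
  rw [e, map_neg, ← e] at h3
  have h7 : ‖z - z'‖ * ‖z - z'‖ ≤ ‖W‖ * ‖z - z'‖ := by nlinarith
  rcases (norm_nonneg (z - z')).eq_or_lt with h0 | h0
  · rw [← h0]; exact norm_nonneg _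
  · exact le_of_mul_le_mul_right h7 h0

end MirrorStep

/-! ### Predictability of the iterates -/

section Iterates

variable {E : Type u} [NormedAddCommGroup E] [NormedSpace ℝ E]
  {Ω : Type v} {X dom : Set E} {ψ f : E → ℝ} {step : ℕ → ℝ} {x₁ : E}
  {g ξ : ℕ → Ω → StrongDual ℝ E} {x : ℕ → Ω → E}

theorem noiseSigma_mono (ξ : ℕ → Ω → StrongDual ℝ E) : Monotone (noiseSigma ξ) := fun _ _ hst =>
  biSup_mono fun _ hi => ⟨hi.1, hi.2.trans hst⟩

theorem measurable_noiseSigma (ξ : ℕ → Ω → StrongDual ℝ E) {t : ℕ} (ht : 1 ≤ t) :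
    Measurable[noiseSigma ξ t] (ξ t) :=
  Measurable.of_comap_le (le_biSup (fun s => MeasurableSpace.comap (ξ s) inferInstance)
    (show t ∈ Set.Icc 1 t from ⟨ht, le_rfl⟩))

variable [FiniteDimensional ℝ E]

theorem IsMirrorDescent.mem (h : IsMirrorDescent X dom ψ f step x₁ g ξ x)
    (hψ : IsRegularizer X dom ψ) (hX : Convex ℝ X) (hstep : ∀ t, 1 ≤ t → 0 < step t) {t : ℕ}
    (ht : 1 ≤ t) (ω : Ω) : x t ω ∈ X ∩ interior dom := by
  obtain rfl | ⟨t, rfl, ht'⟩ : t = 1 ∨ ∃ s, t = s + 1 ∧ 1 ≤ s := by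
    rcases ht.eq_or_lt with h | h
    · exact .inl h.symm
    · exact .inr ⟨t - 1, by omega, by omega⟩
  · rw [h.start]; exact h.start_mem
  · have hm := h.update_mem t ht' ω
    exact ⟨hm, hψ.mem_interior_of_isMinOn hX h.start_mem hm (hstep t ht') (h.update_min t ht' ω)⟩

/-- The iterates are predictable: `x (t + 1)` is a continuous function of the dual vector
`step t • (g t - ξ t) - ∇ψ (x t)`. -/
theorem IsMirrorDescent.measurable [MeasurableSpace E] [BorelSpace E]
    (h : IsMirrorDescent X dom ψ f step x₁ g ξ x)
    (hψ : IsRegularizer X dom ψ) (hX : Convex ℝ X) (hstep : ∀ t, 1 ≤ t → 0 < step t)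
    (hg : ∀ t, 1 ≤ t → Measurable[noiseSigma ξ t] (g t)) {t : ℕ} (ht : 1 ≤ t) :
    Measurable[noiseSigma ξ (t - 1)] (x t) := by
  induction t, ht using Nat.le_induction with
  | base =>
    rw [show x 1 = fun _ => x₁ from funext h.start]
    exact measurable_const
  | succ t ht ih =>
    rw [Nat.add_sub_cancel]
    -- extend the nonexpansive dependence of `x (t + 1)` on `U` to the whole dual space
    let U : Ω → StrongDual ℝ E := fun ω => step t • (g t ω - ξ t ω) - fderiv ℝ ψ (x t ω)
    have hU : Measurable[noiseSigma ξ t] U := by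
      have : ProperSpace E := FiniteDimensional.proper ℝ E
      have hx : Measurable[noiseSigma ξ t] (x t) :=
        ih.mono (noiseSigma_mono ξ (Nat.sub_le t 1)) le_rfl
      have : ProperSpace (StrongDual ℝ E) := FiniteDimensional.proper ℝ _
      have hgξ : Measurable[noiseSigma ξ t] (fun ω => g t ω - ξ t ω) :=
        (hg t ht).sub (measurable_noiseSigma ξ ht)
      exact (hgξ.const_smul (step t)).sub ((measurable_fderiv ℝ ψ).comp hx)
    have hlip : ∀ ω ω', ‖x (t + 1) ω - x (t + 1) ω'‖ ≤ ‖U ω - U ω'‖ := fun ω ω' =>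
      have h1 := h.mem hψ hX hstep (Nat.le_add_left 1 t) ω
      have h2 := h.mem hψ hX hstep (Nat.le_add_left 1 t) ω'
      hψ.norm_update_sub_le hX h1.1 h1.2 h2.1 h2.2 (hstep t ht) (h.update_min t ht ω)
        (h.update_min t ht ω')
    have hfac : Function.FactorsThrough (x (t + 1)) U := fun ω ω' he => by
      have := hlip ω ω'
      rw [he, sub_self, norm_zero] at this
      exact sub_eq_zero.1 (norm_le_zero_iff.1 this)
    let Q : StrongDual ℝ E → E := Function.extend U (x (t + 1)) 0
    have hQ : ∀ ω, Q (U ω) = x (t + 1) ω := fun ω => hfac.extend_apply 0 ω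
    have hQlip : LipschitzOnWith 1 Q (Set.range U) := by
      refine LipschitzOnWith.of_dist_le_mul ?_
      rintro _ ⟨ω, rfl⟩ _ ⟨ω', rfl⟩
      rw [hQ, hQ, dist_eq_norm, dist_eq_norm, NNReal.coe_one, one_mul]
      exact hlip ω ω'
    obtain ⟨Q', hQ', heq⟩ := hQlip.extend_finite_dimension
    have : x (t + 1) = Q' ∘ U := funext fun ω => by
      rw [Function.comp, ← heq ⟨ω, rfl⟩, hQ]
    rw [this]
    exact hQ'.continuous.measurable.comp hU

end Iterates

/-! ### A Fuk–Nagaev inequality for martingale differences -/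

section TailBound

/-- A pointwise bound on a truncated exponential. Where `lam * w ≤ q` the quadratic Taylor bound
applies; where `q ≤ lam * w ≤ lam * L` the function `u ↦ u ^ (-q) * exp u` is increasing on
`[q, ∞)`, which bounds `exp (lam * w)` by a multiple of `w ^ q`; where `w > L` the left side is `0`
and the last term absorbs `lam * y`. -/
theorem truncated_exp_le {q lam L y w : ℝ} (hq : 1 ≤ q) (hlam : 0 < lam) (hL : 0 < L)
    (hyw : |y| ≤ w) :
    (if w ≤ L then Real.exp (lam * y) else 0) ≤
      1 + lam * y + Real.exp q * lam ^ 2 * w ^ 2 + Real.exp (lam * L) / L ^ q * w ^ q := by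
  have hw : 0 ≤ w := (abs_nonneg y).trans hyw
  have hLq : 0 < L ^ q := Real.rpow_pos_of_pos hL q
  have hA : 0 ≤ Real.exp q * lam ^ 2 * w ^ 2 := by positivity
  have hB : 0 ≤ Real.exp (lam * L) / L ^ q * w ^ q := by positivity
  have hu : |lam * y| ≤ lam * w := by
    rw [abs_mul, abs_of_pos hlam]; exact mul_le_mul_of_nonneg_left hyw hlam.le
  have hu' := abs_le.1 hu
  split_ifs with hwL
  · rcases le_total (lam * w) q with h | h
    · -- second-order Taylor bound
      have h1 : Real.exp (lam * y) ≤ 1 + lam * y + (lam * y) ^ 2 * Real.exp |lam * y| := by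
        have h2 := Complex.norm_exp_sub_sum_le_norm_mul_exp ((lam * y : ℝ) : ℂ) 2
        have h3 : (Complex.exp ((lam * y : ℝ) : ℂ) -
            ∑ m ∈ Finset.range 2, ((lam * y : ℝ) : ℂ) ^ m / (m.factorial : ℂ)) =
            ((Real.exp (lam * y) - (1 + lam * y) : ℝ) : ℂ) := by
          simp [Finset.sum_range_succ]
        rw [h3, Complex.norm_real, Complex.norm_real, Real.norm_eq_abs, Real.norm_eq_abs,
          sq_abs] at h2
        linarith [le_abs_self (Real.exp (lam * y) - (1 + lam * y))]
      have h2 : (lam * y) ^ 2 * Real.exp |lam * y| ≤ (lam * w) ^ 2 * Real.exp q := by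
        refine mul_le_mul ?_ (Real.exp_le_exp.2 (hu.trans h)) (Real.exp_pos _).le (sq_nonneg _)
        rw [← sq_abs]; gcongr
      nlinarith
    · have hw0 : 0 < w := by
        rcases hw.eq_or_lt with h0 | h0
        · rw [← h0] at h; linarith [mul_zero lam]
        · exact h0
      have h1 : Real.exp (lam * w) ≤ Real.exp (lam * L) / L ^ q * w ^ q := by
        rw [div_mul_eq_mul_div, le_div_iff₀ hLq, Real.rpow_def_of_pos hL,
          Real.rpow_def_of_pos hw0, ← Real.exp_add, ← Real.exp_add, Real.exp_le_exp]
        have h2 : Real.log (L / w) ≤ L / w - 1 := Real.log_le_sub_one_of_pos (by positivity)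
        rw [Real.log_div hL.ne' hw0.ne'] at h2
        have h3 : (L / w - 1) * q ≤ lam * L - lam * w := by
          have h4 : L / w - 1 = (L - w) / w := by field_simp
          rw [h4, div_mul_eq_mul_div, div_le_iff₀ hw0]
          nlinarith
        nlinarith
      have h2 : Real.exp (lam * y) ≤ 1 + lam * y + Real.exp (lam * w) := by
        rcases le_total 0 y with h3 | h3
        · have : Real.exp (lam * y) ≤ Real.exp (lam * w) := Real.exp_le_exp.2 hu'.2
          nlinarith
        · have h4 : Real.exp (lam * y) ≤ 1 := Real.exp_le_one_iff.2 (by nlinarith)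
          have h5 := Real.add_one_le_exp (lam * w)
          linarith [hu'.1]
      linarith
  · have hwL' : L ≤ w := (not_le.1 hwL).le
    have h1 : lam * w ≤ Real.exp (lam * L) / L ^ q * w ^ q := by
      have h2 : w / L ≤ (w / L) ^ q := by
        have h3 : 1 ≤ w / L := (one_le_div hL).2 hwL'
        simpa using Real.rpow_le_rpow_of_exponent_le h3 hq
      have h3 : Real.exp (lam * L) / L ^ q * w ^ q = Real.exp (lam * L) * (w / L) ^ q := by
        rw [Real.div_rpow hw hL.le]; ring
      have h4 : lam * L ≤ Real.exp (lam * L) := by linarith [Real.add_one_le_exp (lam * L)]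
      calc lam * w = (lam * L) * (w / L) := by field_simp
        _ ≤ Real.exp (lam * L) * (w / L) ^ q :=
          mul_le_mul h4 h2 (by positivity) (Real.exp_pos _).le
        _ = _ := h3.symm
    linarith [hu'.1]

variable {Ω : Type v} {m₀ : MeasurableSpace Ω} {μ : Measure Ω} [IsProbabilityMeasure μ]

theorem integral_mul_le_of_condExp_le {m : MeasurableSpace Ω} (hm : m ≤ m₀) {P Y : Ω → ℝ}
    {K c : ℝ} (hP : StronglyMeasurable[m] P) (hP0 : ∀ ω, 0 ≤ P ω) (hPK : ∀ ω, P ω ≤ K)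
    (hY : Integrable Y μ) (hc : μ[Y | m] ≤ᵐ[μ] fun _ => c) :
    ∫ ω, P ω * Y ω ∂μ ≤ c * ∫ ω, P ω ∂μ := by
  have hb : ∀ᵐ ω ∂μ, ‖P ω‖ ≤ K := ae_of_all _ fun ω => by
    rw [Real.norm_of_nonneg (hP0 ω)]; exact hPK ω
  have hPm : AEStronglyMeasurable[m₀] P μ := (hP.mono hm).aestronglyMeasurable
  have h1 : ∫ ω, P ω * Y ω ∂μ = ∫ ω, P ω * (μ[Y | m]) ω ∂μ := by
    rw [← integral_condExp (f := fun ω => P ω * Y ω) hm]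
    exact integral_congr_ae (condExp_stronglyMeasurable_mul_of_bound hm hP hY K hb)
  rw [h1, ← integral_const_mul]
  refine integral_mono_ae (integrable_condExp.bdd_mul hPm hb)
    ((Integrable.of_bound hPm K hb).const_mul c) ?_
  filter_upwards [hc] with ω hω
  rw [mul_comm c]
  exact mul_le_mul_of_nonneg_left hω (hP0 ω)

/-- A Fuk–Nagaev inequality for martingale differences, in Chernoff form: the sum of the `Y t` is
controlled by conditional bounds on the mean, the second moment and the `q`-th moment of a
dominating sequence `V t`, on the event that every `V t` is at most `L`. -/
theorem measure_lt_sum_and_forall_le {ℱ : ℕ → MeasurableSpace Ω} (hmono : Monotone ℱ)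
    (hle : ∀ t, ℱ t ≤ m₀) {Y V : ℕ → Ω → ℝ} {m a b : ℕ → ℝ} {q lam L : ℝ} (hq : 1 ≤ q)
    (hlam : 0 < lam) (hL : 0 < L)
    (hYm : ∀ t, 1 ≤ t → Measurable[ℱ t] (Y t)) (hVm : ∀ t, 1 ≤ t → Measurable[ℱ t] (V t))
    (hYV : ∀ t, 1 ≤ t → ∀ ω, |Y t ω| ≤ V t ω)
    (hYi : ∀ t, 1 ≤ t → Integrable (Y t) μ)
    (hV2i : ∀ t, 1 ≤ t → Integrable (fun ω => V t ω ^ 2) μ)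
    (hVqi : ∀ t, 1 ≤ t → Integrable (fun ω => V t ω ^ q) μ)
    (hY : ∀ t, 1 ≤ t → μ[Y t | ℱ (t - 1)] ≤ᵐ[μ] fun _ => m t)
    (hV2 : ∀ t, 1 ≤ t → μ[fun ω => V t ω ^ 2 | ℱ (t - 1)] ≤ᵐ[μ] fun _ => a t)
    (hVq : ∀ t, 1 ≤ t → μ[fun ω => V t ω ^ q | ℱ (t - 1)] ≤ᵐ[μ] fun _ => b t)
    (T : ℕ) (x : ℝ) :
    μ {ω | x < ∑ t ∈ Finset.Icc 1 T, Y t ω ∧ ∀ t ∈ Finset.Icc 1 T, V t ω ≤ L} ≤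
      ENNReal.ofReal (Real.exp (lam * ∑ t ∈ Finset.Icc 1 T, m t
        + Real.exp q * lam ^ 2 * ∑ t ∈ Finset.Icc 1 T, a t
        + Real.exp (lam * L) / L ^ q * ∑ t ∈ Finset.Icc 1 T, b t - lam * x)) := by
  let A : ℕ → Ω → ℝ := fun t ω => if V t ω ≤ L then Real.exp (lam * Y t ω) else 0
  let c₂ : ℝ := Real.exp q * lam ^ 2
  let c₃ : ℝ := Real.exp (lam * L) / L ^ q
  have hc₂ : 0 ≤ c₂ := by positivity
  have hc₃ : 0 ≤ c₃ := by positivity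
  have hA0 : ∀ t ω, 0 ≤ A t ω := fun t ω => by
    simp only [A]; split_ifs <;> positivity
  have hAK : ∀ t, 1 ≤ t → ∀ ω, A t ω ≤ Real.exp (lam * L) := fun t ht ω => by
    simp only [A]
    split_ifs with h
    · exact Real.exp_le_exp.2 (mul_le_mul_of_nonneg_left
        ((le_abs_self _).trans ((hYV t ht ω).trans h)) hlam.le)
    · positivity
  have hAm : ∀ t, 1 ≤ t → Measurable[ℱ t] (A t) := fun t ht =>
    Measurable.ite ((hVm t ht) measurableSet_Iic)
      (((hYm t ht).const_mul lam).exp) measurable_const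
  let Q : ℕ → Ω → ℝ := fun n ω => ∏ t ∈ Finset.Icc 1 n, A t ω
  have hQm : ∀ n, Measurable[ℱ n] (Q n) := fun n =>
    Finset.measurable_fun_prod _ fun t ht =>
      (hAm t (Finset.mem_Icc.1 ht).1).mono (hmono (Finset.mem_Icc.1 ht).2) le_rfl
  have hQ0 : ∀ n ω, 0 ≤ Q n ω := fun n ω => Finset.prod_nonneg fun t _ => hA0 t ω
  have hQK : ∀ n ω, Q n ω ≤ Real.exp (lam * L) ^ n := fun n ω => by
    have := Finset.prod_le_prod (fun t _ => hA0 t ω)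
      fun t (ht : t ∈ Finset.Icc 1 n) => hAK t (Finset.mem_Icc.1 ht).1 ω
    simpa using this
  have hQi : ∀ n, Integrable (Q n) μ := fun n =>
    Integrable.of_bound ((hQm n).mono (hle n) le_rfl).aestronglyMeasurable _
      (ae_of_all _ fun ω => by rw [Real.norm_of_nonneg (hQ0 n ω)]; exact hQK n ω)
  -- the supermartingale step
  have hstep : ∀ n, ∫ ω, Q (n + 1) ω ∂μ ≤
      (1 + (lam * m (n + 1) + c₂ * a (n + 1) + c₃ * b (n + 1))) * ∫ ω, Q n ω ∂μ := fun n => by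
    have hn : 1 ≤ n + 1 := Nat.le_add_left 1 n
    have hQs : StronglyMeasurable[ℱ n] (Q n) := (hQm n).stronglyMeasurable
    have hb : ∀ᵐ ω ∂μ, ‖Q n ω‖ ≤ Real.exp (lam * L) ^ n := ae_of_all _ fun ω => by
      rw [Real.norm_of_nonneg (hQ0 n ω)]; exact hQK n ω
    have hae : AEStronglyMeasurable (Q n) μ := (hQi n).1
    have i1 := integral_mul_le_of_condExp_le (hle n) hQs (hQ0 n) (hQK n) (hYi _ hn) (hY _ hn)
    have i2 := integral_mul_le_of_condExp_le (hle n) hQs (hQ0 n) (hQK n) (hV2i _ hn) (hV2 _ hn)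
    have i3 := integral_mul_le_of_condExp_le (hle n) hQs (hQ0 n) (hQK n) (hVqi _ hn) (hVq _ hn)
    have j1 : Integrable (fun ω => lam * (Q n ω * Y (n + 1) ω)) μ :=
      ((hYi _ hn).bdd_mul hae hb).const_mul lam
    have j2 : Integrable (fun ω => c₂ * (Q n ω * V (n + 1) ω ^ 2)) μ :=
      ((hV2i _ hn).bdd_mul hae hb).const_mul c₂
    have j3 : Integrable (fun ω => c₃ * (Q n ω * V (n + 1) ω ^ q)) μ :=
      ((hVqi _ hn).bdd_mul hae hb).const_mul c₃
    have s1 : Integrable (fun ω => Q n ω + lam * (Q n ω * Y (n + 1) ω)) μ := (hQi n).add j1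
    have s2 : Integrable (fun ω => Q n ω + lam * (Q n ω * Y (n + 1) ω)
        + c₂ * (Q n ω * V (n + 1) ω ^ 2)) μ := s1.add j2
    calc ∫ ω, Q (n + 1) ω ∂μ
        ≤ ∫ ω, (Q n ω + lam * (Q n ω * Y (n + 1) ω) + c₂ * (Q n ω * V (n + 1) ω ^ 2)
            + c₃ * (Q n ω * V (n + 1) ω ^ q)) ∂μ := by
          refine integral_mono (hQi _) (s2.add j3) fun ω => ?_
          have h1 := truncated_exp_le hq hlam hL (hYV _ hn ω)
          have h2 := mul_le_mul_of_nonneg_left h1 (hQ0 n ω)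
          have h3 : Q (n + 1) ω = Q n ω * A (n + 1) ω := Finset.prod_Icc_succ_top hn _
          rw [h3]
          simp only [A, c₂, c₃]
          linarith
      _ = ∫ ω, Q n ω ∂μ + lam * ∫ ω, Q n ω * Y (n + 1) ω ∂μ
            + c₂ * ∫ ω, Q n ω * V (n + 1) ω ^ 2 ∂μ + c₃ * ∫ ω, Q n ω * V (n + 1) ω ^ q ∂μ := by
          rw [integral_add s2 j3, integral_add s1 j2,
            integral_add (hQi n) j1, integral_const_mul, integral_const_mul, integral_const_mul]
      _ ≤ _ := by
          have k1 := mul_le_mul_of_nonneg_left i1 hlam.le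
          have k2 := mul_le_mul_of_nonneg_left i2 hc₂
          have k3 := mul_le_mul_of_nonneg_left i3 hc₃
          linarith
  have hmain : ∀ n, ∫ ω, Q n ω ∂μ ≤ Real.exp (lam * ∑ t ∈ Finset.Icc 1 n, m t
      + c₂ * ∑ t ∈ Finset.Icc 1 n, a t + c₃ * ∑ t ∈ Finset.Icc 1 n, b t) := fun n => by
    induction n with
    | zero => simp [Q]
    | succ n ih =>
      refine (hstep n).trans ?_
      have h1 := Real.add_one_le_exp (lam * m (n + 1) + c₂ * a (n + 1) + c₃ * b (n + 1))
      have hn : 1 ≤ n + 1 := Nat.le_add_left 1 n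
      rw [Finset.sum_Icc_succ_top hn, Finset.sum_Icc_succ_top hn, Finset.sum_Icc_succ_top hn]
      calc _ ≤ Real.exp (lam * m (n + 1) + c₂ * a (n + 1) + c₃ * b (n + 1)) * _ :=
            mul_le_mul (by linarith) ih (integral_nonneg (hQ0 n)) (Real.exp_pos _).le
        _ = _ := by rw [← Real.exp_add]; congr 1; ring
  have hmarkov := mul_meas_ge_le_integral_of_nonneg (ae_of_all _ (hQ0 T)) (hQi T)
    (Real.exp (lam * x))
  rw [mul_comm, ← le_div_iff₀ (Real.exp_pos _)] at hmarkov
  have hsub : {ω | x < ∑ t ∈ Finset.Icc 1 T, Y t ω ∧ ∀ t ∈ Finset.Icc 1 T, V t ω ≤ L} ⊆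
      {ω | Real.exp (lam * x) ≤ Q T ω} := fun ω hω => by
    have h1 : Q T ω = Real.exp (lam * ∑ t ∈ Finset.Icc 1 T, Y t ω) := by
      rw [Finset.mul_sum, Real.exp_sum]
      exact Finset.prod_congr rfl fun t ht => if_pos (hω.2 t ht)
    rw [Set.mem_ofPred_eq, h1, Real.exp_le_exp]
    exact mul_le_mul_of_nonneg_left hω.1.le hlam.le
  refine (measure_mono hsub).trans ?_
  rw [← ofReal_measureReal]
  refine ENNReal.ofReal_le_ofReal (hmarkov.trans ?_)
  rw [Real.exp_sub]
  gcongr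
  exact hmain T

/-- The Fuk–Nagaev inequality with failure probability `δ / 3`. With `ℓ = log (e / δ)` the
exponential rate is `ℓ / M`; the choice of `L` makes the truncation term at most `e / 3`. -/
theorem measure_lt_sum_and_forall_le_of_rpow_eq {ℱ : ℕ → MeasurableSpace Ω} (hmono : Monotone ℱ)
    (hle : ∀ t, ℱ t ≤ m₀) {Y V : ℕ → Ω → ℝ} {m a b : ℕ → ℝ} {q L M δ : ℝ} (hq : 1 ≤ q)
    (hL : 0 < L) (hLM : L ≤ M) (hδ : 0 < δ) (hδ1 : δ < 1)
    (hYm : ∀ t, 1 ≤ t → Measurable[ℱ t] (Y t)) (hVm : ∀ t, 1 ≤ t → Measurable[ℱ t] (V t))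
    (hYV : ∀ t, 1 ≤ t → ∀ ω, |Y t ω| ≤ V t ω)
    (hYi : ∀ t, 1 ≤ t → Integrable (Y t) μ)
    (hV2i : ∀ t, 1 ≤ t → Integrable (fun ω => V t ω ^ 2) μ)
    (hVqi : ∀ t, 1 ≤ t → Integrable (fun ω => V t ω ^ q) μ)
    (hY : ∀ t, 1 ≤ t → μ[Y t | ℱ (t - 1)] ≤ᵐ[μ] fun _ => m t)
    (hV2 : ∀ t, 1 ≤ t → μ[fun ω => V t ω ^ 2 | ℱ (t - 1)] ≤ᵐ[μ] fun _ => a t)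
    (hVq : ∀ t, 1 ≤ t → μ[fun ω => V t ω ^ q | ℱ (t - 1)] ≤ᵐ[μ] fun _ => b t)
    (T : ℕ) (hLb : L ^ q = 3 * (∑ t ∈ Finset.Icc 1 T, b t) / δ) :
    μ {ω | ∑ t ∈ Finset.Icc 1 T, m t
        + Real.exp q * (Real.log (Real.exp 1 / δ) / M) * ∑ t ∈ Finset.Icc 1 T, a t + 3 * M
        < ∑ t ∈ Finset.Icc 1 T, Y t ω ∧ ∀ t ∈ Finset.Icc 1 T, V t ω ≤ L} ≤
      ENNReal.ofReal (δ / 3) := by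
  have hM : 0 < M := hL.trans_le hLM
  set l := Real.log (Real.exp 1 / δ) with hl
  have hl' : l = 1 - Real.log δ := by
    rw [hl, Real.log_div (Real.exp_ne_zero 1) hδ.ne', Real.log_exp]
  have hl1 : 1 ≤ l := by linarith [Real.log_neg hδ hδ1]
  have hlam : 0 < l / M := by positivity
  refine (measure_lt_sum_and_forall_le hmono hle hq hlam hL hYm hVm hYV hYi hV2i hVqi hY hV2 hVq
    T _).trans (ENNReal.ofReal_le_ofReal ?_)
  have hb : Real.exp (l / M * L) / L ^ q * ∑ t ∈ Finset.Icc 1 T, b t ≤ 1 := by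
    have h1 : l / M * L ≤ l := by
      rw [div_mul_eq_mul_div, div_le_iff₀ hM]; gcongr
    have h2 : Real.exp (l / M * L) ≤ Real.exp 1 / δ := by
      refine (Real.exp_le_exp.2 h1).trans_eq ?_
      rw [hl, Real.exp_log (by positivity)]
    have h3 : (∑ t ∈ Finset.Icc 1 T, b t) = L ^ q * δ / 3 := by rw [hLb]; field_simp
    have h4 : L ^ q ≠ 0 := (Real.rpow_pos_of_pos hL q).ne'
    calc _ = Real.exp (l / M * L) * (δ / 3) := by rw [h3]; field_simp
      _ ≤ Real.exp 1 / δ * (δ / 3) := by gcongr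
      _ = Real.exp 1 / 3 := by field_simp
      _ ≤ 1 := by linarith [Real.exp_one_lt_d9]
  have hexp : Real.exp (1 - 3 * l) ≤ δ / 3 := by
    have h1 : 1 - 3 * l = -2 + 3 * Real.log δ := by rw [hl']; ring
    have h2 : Real.exp (3 * Real.log δ) = δ ^ 3 := by
      rw [mul_comm, Real.exp_mul, Real.exp_log hδ]; norm_cast
    have h3 : Real.exp (-2) ≤ 1 / 3 := by
      rw [Real.exp_neg, ← one_div]
      exact one_div_le_one_div_of_le (by norm_num) (by linarith [Real.add_one_le_exp 2])
    have h4 : δ ^ 3 ≤ δ := pow_le_of_le_one hδ.le hδ1.le (by norm_num)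
    rw [h1, Real.exp_add, h2]
    calc Real.exp (-2) * δ ^ 3 ≤ 1 / 3 * δ :=
          mul_le_mul h3 h4 (by positivity) (by norm_num)
      _ = δ / 3 := by ring
  refine (Real.exp_le_exp.2 ?_).trans hexp
  have h5 : l / M * (3 * M) = 3 * l := by field_simp
  nlinarith

end TailBound

/-! ### Conditional moments of the noise -/

section NoiseMoments

variable {E : Type u} [NormedAddCommGroup E] [NormedSpace ℝ E]
  {Ω : Type v} {m₀ : MeasurableSpace Ω} {μ : Measure Ω}
  {ξ : ℕ → Ω → StrongDual ℝ E} {p φ : ℝ}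

theorem IsPolyNoise.noiseSigma_le (h : IsPolyNoise μ ξ p φ) (t : ℕ) : noiseSigma ξ t ≤ m₀ :=
  iSup₂_le fun s hs => (h.measurable s hs.1).comap_le

theorem IsPolyNoise.condExp_const_mul_rpow_le (h : IsPolyNoise μ ξ p φ) {t : ℕ} (ht : 1 ≤ t)
    {c : ℝ} (hc : 0 ≤ c) :
    μ[fun ω => c * (‖ξ t ω‖ / φ) ^ p | noiseSigma ξ (t - 1)] ≤ᵐ[μ] fun _ => c := by
  filter_upwards [condExp_smul (μ := μ) c (fun ω => (‖ξ t ω‖ / φ) ^ p) (noiseSigma ξ (t - 1)),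
    h.condMoment t ht] with ω h1 h2
  refine h1.le.trans ?_
  rw [Pi.smul_apply, smul_eq_mul]
  exact mul_le_of_le_one_right hc h2

variable [IsProbabilityMeasure μ]

theorem IsPolyNoise.integrable_of_le (h : IsPolyNoise μ ξ p φ) {t : ℕ} (ht : 1 ≤ t)
    {Z : Ω → ℝ} {c : ℝ} (hZm : Measurable Z)
    (hZ : ∀ ω, |Z ω| ≤ c * (1 + (‖ξ t ω‖ / φ) ^ p)) : Integrable Z μ :=
  (((integrable_const (1 : ℝ)).add (h.integrable t ht)).const_mul c).mono'
    hZm.aestronglyMeasurable (ae_of_all _ hZ)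

theorem IsPolyNoise.condExp_le_two_mul (h : IsPolyNoise μ ξ p φ) {t : ℕ} (ht : 1 ≤ t)
    {Z : Ω → ℝ} {c : ℝ} (hc : 0 ≤ c) (hZm : Measurable Z)
    (hZ : ∀ ω, |Z ω| ≤ c * (1 + (‖ξ t ω‖ / φ) ^ p)) :
    μ[Z | noiseSigma ξ (t - 1)] ≤ᵐ[μ] fun _ => 2 * c := by
  have h1 : Integrable (fun ω => 1 + (‖ξ t ω‖ / φ) ^ p) μ :=
    (integrable_const (1 : ℝ)).add (h.integrable t ht)
  have h2 : μ[Z | noiseSigma ξ (t - 1)] ≤ᵐ[μ]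
      μ[c • fun ω => 1 + (‖ξ t ω‖ / φ) ^ p | noiseSigma ξ (t - 1)] :=
    condExp_mono (h.integrable_of_le ht hZm hZ) (h1.smul c)
      (ae_of_all _ fun ω => (le_abs_self _).trans (hZ ω))
  have h3 := condExp_smul (μ := μ) c (fun ω => 1 + (‖ξ t ω‖ / φ) ^ p) (noiseSigma ξ (t - 1))
  have h4 := condExp_add (integrable_const (1 : ℝ)) (h.integrable t ht) (noiseSigma ξ (t - 1))
  have h5 : μ[fun _ => (1 : ℝ) | noiseSigma ξ (t - 1)] = fun _ => 1 :=
    condExp_const (h.noiseSigma_le (t - 1)) 1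
  rw [h5] at h4
  filter_upwards [h2, h3, h4, h.condMoment t ht] with ω g2 g3 g4 g5
  refine g2.trans ?_
  rw [g3, Pi.smul_apply, smul_eq_mul]
  have g6 : (μ[fun ω => 1 + (‖ξ t ω‖ / φ) ^ p | noiseSigma ξ (t - 1)]) ω ≤ 1 + 1 := by
    refine g4.le.trans ?_
    exact add_le_add le_rfl g5
  nlinarith

/-- The truncation event has small probability, by Markov's inequality for the `p`-th moment. -/
theorem IsPolyNoise.measure_lt_mul_le (h : IsPolyNoise μ ξ p φ) (hp : 0 < p) (hφ : 0 < φ) {t : ℕ}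
    (ht : 1 ≤ t) {c L : ℝ} (hc : 0 ≤ c) (hL : 0 < L) :
    μ {ω | L < c * (‖ξ t ω‖ / φ)} ≤ ENNReal.ofReal (c ^ p / L ^ p) := by
  have hLp : 0 < L ^ p := Real.rpow_pos_of_pos hL p
  have hcp : 0 ≤ c ^ p := Real.rpow_nonneg hc p
  have h1 : ∫ ω, c ^ p * (‖ξ t ω‖ / φ) ^ p ∂μ ≤ c ^ p := by
    rw [← integral_condExp (f := fun ω => c ^ p * (‖ξ t ω‖ / φ) ^ p) (h.noiseSigma_le (t - 1))]
    refine (integral_mono_ae integrable_condExp (integrable_const _)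
      (h.condExp_const_mul_rpow_le ht hcp)).trans_eq ?_
    simp
  have h2 := mul_meas_ge_le_integral_of_nonneg (μ := μ)
    (f := fun ω => c ^ p * (‖ξ t ω‖ / φ) ^ p) (ae_of_all _ fun ω => by positivity)
    ((h.integrable t ht).const_mul _) (L ^ p)
  rw [mul_comm, ← le_div_iff₀ hLp] at h2
  have hsub : {ω | L < c * (‖ξ t ω‖ / φ)} ⊆ {ω | L ^ p ≤ c ^ p * (‖ξ t ω‖ / φ) ^ p} :=
    fun ω hω => by
      rw [Set.mem_ofPred_eq, ← Real.mul_rpow hc (by positivity)]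
      exact Real.rpow_le_rpow hL.le (le_of_lt hω) hp.le
  refine (measure_mono hsub).trans ?_
  rw [← ofReal_measureReal]
  exact ENNReal.ofReal_le_ofReal (h2.trans (by gcongr))

variable [FiniteDimensional ℝ E]

theorem IsPolyNoise.integrable_noise (h : IsPolyNoise μ ξ p φ) (hp : 1 ≤ p) (hφ : 0 < φ) {t : ℕ}
    (ht : 1 ≤ t) : Integrable (ξ t) μ := by
  have : ProperSpace (StrongDual ℝ E) := FiniteDimensional.proper ℝ _
  refine (((integrable_const (1 : ℝ)).add (h.integrable t ht)).const_mul φ).mono'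
    (h.measurable t ht).aestronglyMeasurable (ae_of_all _ fun ω => ?_)
  have h0 : 0 ≤ ‖ξ t ω‖ / φ := by positivity
  have h1 : ‖ξ t ω‖ / φ ≤ 1 + (‖ξ t ω‖ / φ) ^ p := by
    rcases le_total (‖ξ t ω‖ / φ) 1 with h2 | h2
    · linarith [Real.rpow_nonneg h0 p]
    · have := Real.rpow_le_rpow_of_exponent_le h2 hp
      rw [Real.rpow_one] at this
      linarith
  calc ‖ξ t ω‖ = φ * (‖ξ t ω‖ / φ) := by field_simp
    _ ≤ _ := mul_le_mul_of_nonneg_left h1 hφ.le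

/-- The noise paired with a bounded predictable vector is a martingale difference. -/
theorem IsPolyNoise.condExp_apply_eq_zero [MeasurableSpace E] [BorelSpace E]
    (h : IsPolyNoise μ ξ p φ) (hp : 1 ≤ p) (hφ : 0 < φ) {t : ℕ} (ht : 1 ≤ t) {z : Ω → E}
    (hz : Measurable[noiseSigma ξ (t - 1)] z) {R : ℝ} (hR : ∀ ω, ‖z ω‖ ≤ R) :
    μ[fun ω => ξ t ω (z ω) | noiseSigma ξ (t - 1)] =ᵐ[μ] 0 := by
  have : ProperSpace E := FiniteDimensional.proper ℝ E
  have hzs : StronglyMeasurable[noiseSigma ξ (t - 1)] z := hz.stronglyMeasurable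
  have h1 := condExp_stronglyMeasurable_bilin_of_bound (μ := μ)
    (ContinuousLinearMap.apply ℝ ℝ : E →L[ℝ] StrongDual ℝ E →L[ℝ] ℝ)
    (h.noiseSigma_le (t - 1)) hzs (h.integrable_noise hp hφ ht) R (ae_of_all _ hR)
  filter_upwards [h1, h.centered t ht] with ω h2 h3
  refine h2.trans ?_
  rw [h3]
  simp

end NoiseMoments

/-! ### The stopping argument -/

section Regret

open Classical in
/-- The deterministic part of the regret bound: the noise terms only enter through the sum of the
`w t * n t` stopped when the distance `D` first exceeds `R`. If `D` exceeded `R` for the first time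
at step `k + 1`, the stopped sum would be the sum up to `k`, and the recursion would give
`D (k + 1) ≤ R`. -/
theorem sum_regret_le {T : ℕ} {B d w D n θ : ℕ → ℝ} {η φ G R X₁ X₂ : ℝ} (hη : 0 < η)
    (hR : 0 ≤ R) (hw : ∀ t, 1 ≤ t → 0 ≤ w t) (hd : ∀ t, 1 ≤ t → 0 ≤ d t)
    (hD : ∀ t, 1 ≤ t → D t ^ 2 ≤ 2 * B t)
    (hstep : ∀ t, 1 ≤ t → B (t + 1) ≤
      B t - η * w t * d t + η * (w t * n t) + η ^ 2 * (w t ^ 2 * (G ^ 2 + φ ^ 2 * θ t ^ 2)))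
    (h₂ : ∑ t ∈ Finset.Icc 1 T, w t * (if ∀ s ∈ Finset.Icc 1 t, D s ≤ R then n t else 0)
      ≤ R * φ * X₂)
    (h₁ : ∑ t ∈ Finset.Icc 1 T, w t ^ 2 * θ t ^ 2 ≤ X₁)
    (hR2 : 4 * (B 1 + η ^ 2 * (G ^ 2 * ∑ t ∈ Finset.Icc 1 T, w t ^ 2 + φ ^ 2 * X₁)
      + η ^ 2 * φ ^ 2 * X₂ ^ 2) ≤ R ^ 2) :
    ∑ t ∈ Finset.Icc 1 T, η * w t * d t ≤ R ^ 2 := by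
  have htel : ∀ k, B (k + 1) + ∑ t ∈ Finset.Icc 1 k, η * w t * d t ≤
      B 1 + η * ∑ t ∈ Finset.Icc 1 k, w t * n t +
        η ^ 2 * ∑ t ∈ Finset.Icc 1 k, w t ^ 2 * (G ^ 2 + φ ^ 2 * θ t ^ 2) := fun k => by
    induction k with
    | zero => simp
    | succ k ih =>
      have hk : 1 ≤ k + 1 := Nat.le_add_left 1 k
      rw [Finset.sum_Icc_succ_top hk, Finset.sum_Icc_succ_top hk, Finset.sum_Icc_succ_top hk]
      have := hstep (k + 1) hk
      linarith
  have hnoise : ∀ k ≤ T, ∑ t ∈ Finset.Icc 1 k, w t ^ 2 * (G ^ 2 + φ ^ 2 * θ t ^ 2) ≤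
      G ^ 2 * ∑ t ∈ Finset.Icc 1 T, w t ^ 2 + φ ^ 2 * X₁ := fun k hk =>
    calc _ ≤ ∑ t ∈ Finset.Icc 1 T, w t ^ 2 * (G ^ 2 + φ ^ 2 * θ t ^ 2) :=
          Finset.sum_le_sum_of_subset_of_nonneg (Finset.Icc_subset_Icc_right hk)
            fun t _ _ => by positivity
      _ = G ^ 2 * ∑ t ∈ Finset.Icc 1 T, w t ^ 2
            + φ ^ 2 * ∑ t ∈ Finset.Icc 1 T, w t ^ 2 * θ t ^ 2 := by
          rw [Finset.mul_sum, Finset.mul_sum, ← Finset.sum_add_distrib]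
          exact Finset.sum_congr rfl fun t _ => by ring
      _ ≤ _ := by gcongr
  have hkey : ∀ k ≤ T, (∀ s ∈ Finset.Icc 1 k, D s ≤ R) → (k = T ∨ R < D (k + 1)) →
      B (k + 1) + ∑ t ∈ Finset.Icc 1 k, η * w t * d t ≤ R ^ 2 / 2 := fun k hk hin hout => by
    have hsum : ∑ t ∈ Finset.Icc 1 k, w t * n t =
        ∑ t ∈ Finset.Icc 1 T, w t * (if ∀ s ∈ Finset.Icc 1 t, D s ≤ R then n t else 0) := by
      rw [← Finset.sum_subset (Finset.Icc_subset_Icc_right hk)]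
      · refine Finset.sum_congr rfl fun t ht => ?_
        rw [if_pos fun s hs => hin s (Finset.Icc_subset_Icc_right (Finset.mem_Icc.1 ht).2 hs)]
      · intro t ht htk
        rw [Finset.mem_Icc] at ht htk
        have hkt : k < t := by omega
        rcases hout with rfl | hout
        · omega
        · rw [if_neg, mul_zero]
          intro hall
          exact absurd (hall (k + 1) (Finset.mem_Icc.2 ⟨by omega, hkt⟩)) (not_le.2 hout)
    have h3 := htel k
    rw [hsum] at h3
    have h4 := mul_le_mul_of_nonneg_left (hnoise k hk) (sq_nonneg η)
    have h5 := mul_le_mul_of_nonneg_left h₂ hη.le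
    nlinarith [sq_nonneg (R - 2 * η * φ * X₂)]
  have hall : ∀ k ≤ T, ∀ s ∈ Finset.Icc 1 k, D s ≤ R := fun k => by
    induction k with
    | zero => simp
    | succ k ih =>
      intro hk s hs
      have hin := ih (by omega)
      rcases (Finset.mem_Icc.1 hs).2.lt_or_eq with h | rfl
      · exact hin s (Finset.mem_Icc.2 ⟨(Finset.mem_Icc.1 hs).1, by omega⟩)
      · by_contra hlt
        have h1 := hkey k (by omega) hin (.inr (not_le.1 hlt))
        have h2 : 0 ≤ ∑ t ∈ Finset.Icc 1 k, η * w t * d t := Finset.sum_nonneg fun t ht =>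
          mul_nonneg (mul_nonneg hη.le (hw t (Finset.mem_Icc.1 ht).1)) (hd t (Finset.mem_Icc.1 ht).1)
        have h3 := hD (k + 1) (Nat.le_add_left 1 k)
        exact hlt (abs_le_of_sq_le_sq' (by linarith) hR).2
  have h1 := hkey T le_rfl (hall T le_rfl) (.inl rfl)
  have h2 := hD (T + 1) (Nat.le_add_left 1 T)
  nlinarith [sq_nonneg (D (T + 1)), sq_nonneg R]

end Regret

/-! ### Tails of the two noise sums -/

section NoiseSums

variable {E : Type u} [NormedAddCommGroup E] [NormedSpace ℝ E] [FiniteDimensional ℝ E]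
  {Ω : Type v} {m₀ : MeasurableSpace Ω} {μ : Measure Ω} [IsProbabilityMeasure μ]
  {ξ : ℕ → Ω → StrongDual ℝ E} {p φ L δ : ℝ} {w : ℕ → ℝ}

theorem pow_le_one_add_rpow {r p : ℝ} (hr : 0 ≤ r) {k : ℕ} (hkp : (k : ℝ) ≤ p) :
    r ^ k ≤ 1 + r ^ p := by
  rcases le_total r 1 with h | h
  · linarith [pow_le_one₀ (n := k) hr h, Real.rpow_nonneg hr p]
  · have := Real.rpow_le_rpow_of_exponent_le h hkp
    rw [Real.rpow_natCast] at this
    linarith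

/-- The tail of the martingale `∑ w t * ξ t (z t)` for predictable `z t` with `‖z t‖ ≤ R`. The
scale `M = L + √(ℓ * ∑ w t ^ 2)`, with `ℓ = log (e / δ)`, balances the variance term
`ℓ / M * ∑ w t ^ 2` of the Fuk–Nagaev inequality against `M` itself. -/
theorem IsPolyNoise.measure_martingale_gt_le [MeasurableSpace E] [BorelSpace E]
    (h : IsPolyNoise μ ξ p φ) (hp : 4 < p) (hφ : 0 < φ)
    (hw : ∀ t, 1 ≤ t → 0 < w t) (hL : 0 < L) (hδ : 0 < δ) (hδ1 : δ < 1) {T : ℕ}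
    (hLb : L ^ p = 3 * (∑ t ∈ Finset.Icc 1 T, w t ^ p) / δ) {z : ℕ → Ω → E}
    (hz : ∀ t, 1 ≤ t → Measurable[noiseSigma ξ (t - 1)] (z t)) {R : ℝ} (hR0 : 0 < R)
    (hR : ∀ t, 1 ≤ t → ∀ ω, ‖z t ω‖ ≤ R) :
    μ {ω | R * φ * ((2 * Real.exp p + 3) *
          (L + √(Real.log (Real.exp 1 / δ) * ∑ t ∈ Finset.Icc 1 T, w t ^ 2))) <
        ∑ t ∈ Finset.Icc 1 T, w t * ξ t ω (z t ω) ∧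
        ∀ t ∈ Finset.Icc 1 T, w t * (‖ξ t ω‖ / φ) ≤ L} ≤ ENNReal.ofReal (δ / 3) := by
  have : ProperSpace E := FiniteDimensional.proper ℝ E
  have : ProperSpace (StrongDual ℝ E) := FiniteDimensional.proper ℝ _
  set l := Real.log (Real.exp 1 / δ) with hl
  set a := ∑ t ∈ Finset.Icc 1 T, w t ^ 2 with ha
  have hl0 : 0 ≤ l := by
    rw [hl, Real.log_div (Real.exp_ne_zero 1) hδ.ne', Real.log_exp]
    linarith [Real.log_neg hδ hδ1]
  have ha0 : 0 ≤ a := Finset.sum_nonneg fun t _ => sq_nonneg _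
  set M := L + √(l * a) with hM
  have hM0 : 0 < M := by positivity
  have hRφ : 0 < R * φ := mul_pos hR0 hφ
  have hξm := fun t (ht : 1 ≤ t) => measurable_noiseSigma ξ ht
  have hYm : ∀ t, 1 ≤ t → Measurable[noiseSigma ξ t]
      (fun ω => (w t / (R * φ)) * ξ t ω (z t ω)) := fun t ht => by
    have hz' : Measurable[noiseSigma ξ t] (z t) :=
      (hz t ht).mono (noiseSigma_mono ξ (Nat.sub_le t 1)) le_rfl
    have hev : Measurable fun q : StrongDual ℝ E × E => q.1 q.2 :=
      isBoundedBilinearMap_apply.continuous.measurable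
    have : Measurable[noiseSigma ξ t] (fun ω => ξ t ω (z t ω)) :=
      hev.comp ((hξm t ht).prodMk hz')
    exact this.const_mul _
  have hVm : ∀ t, 1 ≤ t → Measurable[noiseSigma ξ t] (fun ω => w t * (‖ξ t ω‖ / φ)) :=
    fun t ht => ((measurable_norm.comp (hξm t ht)).div_const φ).const_mul (w t)
  have hYV : ∀ t, 1 ≤ t → ∀ ω,
      |(w t / (R * φ)) * ξ t ω (z t ω)| ≤ w t * (‖ξ t ω‖ / φ) := fun t ht ω => by
    have h1 : |ξ t ω (z t ω)| ≤ ‖ξ t ω‖ * R :=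
      ((ξ t ω).le_opNorm _).trans (mul_le_mul_of_nonneg_left (hR t ht ω) (norm_nonneg _))
    have h2 : 0 < w t / (R * φ) := div_pos (hw t ht) hRφ
    rw [abs_mul, abs_of_pos h2]
    calc _ ≤ w t / (R * φ) * (‖ξ t ω‖ * R) := by gcongr
      _ = _ := by field_simp
  have hθ : ∀ t ω, 0 ≤ ‖ξ t ω‖ / φ := fun t ω => by positivity
  have hle := h.noiseSigma_le
  have hV1 : ∀ t, 1 ≤ t → ∀ ω,
      |(w t / (R * φ)) * ξ t ω (z t ω)| ≤ w t * (1 + (‖ξ t ω‖ / φ) ^ p) := fun t ht ω => by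
    refine (hYV t ht ω).trans (mul_le_mul_of_nonneg_left ?_ (hw t ht).le)
    simpa using pow_le_one_add_rpow (hθ t ω) (k := 1) (by push_cast; linarith)
  have hV2 : ∀ t, 1 ≤ t → ∀ ω,
      |(w t * (‖ξ t ω‖ / φ)) ^ 2| ≤ w t ^ 2 * (1 + (‖ξ t ω‖ / φ) ^ p) := fun t ht ω => by
    rw [abs_of_nonneg (sq_nonneg _), mul_pow]
    gcongr
    exact pow_le_one_add_rpow (hθ t ω) (by push_cast; linarith)
  have hV2m := fun t ht => ((hVm t ht).mono (hle t) le_rfl).pow_const 2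
  have hVq : ∀ t, 1 ≤ t → (fun ω => (w t * (‖ξ t ω‖ / φ)) ^ p) =
      fun ω => w t ^ p * (‖ξ t ω‖ / φ) ^ p := fun t ht =>
    funext fun ω => Real.mul_rpow (hw t ht).le (hθ t ω)
  have hmain := measure_lt_sum_and_forall_le_of_rpow_eq (μ := μ) (noiseSigma_mono ξ) hle
    (m := fun _ => 0) (a := fun t => 2 * w t ^ 2) (b := fun t => w t ^ p) (q := p) (L := L)
    (M := M) (by linarith) hL (by rw [hM]; linarith [Real.sqrt_nonneg (l * a)]) hδ hδ1
    hYm hVm hYV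
    (fun t ht => h.integrable_of_le ht ((hYm t ht).mono (hle t) le_rfl) (hV1 t ht))
    (fun t ht => h.integrable_of_le ht (hV2m t ht) (hV2 t ht))
    (fun t ht => by rw [hVq t ht]; exact (h.integrable t ht).const_mul _)
    (fun t ht => by
      have e : (fun ω => (w t / (R * φ)) * ξ t ω (z t ω)) =
          (w t / (R * φ)) • fun ω => ξ t ω (z t ω) := rfl
      rw [e]
      filter_upwards [condExp_smul (μ := μ) (w t / (R * φ)) (fun ω => ξ t ω (z t ω))
        (noiseSigma ξ (t - 1)), h.condExp_apply_eq_zero (by linarith) hφ ht (hz t ht) (hR t ht)]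
        with ω h1 h2
      rw [h1, Pi.smul_apply, h2]
      simp)
    (fun t ht => h.condExp_le_two_mul ht (sq_nonneg _) (hV2m t ht) (hV2 t ht))
    (fun t ht => by
      rw [hVq t ht]
      exact h.condExp_const_mul_rpow_le ht (Real.rpow_nonneg (hw t ht).le p)) T hLb
  refine (measure_mono ?_).trans hmain
  intro ω hω
  refine ⟨?_, hω.2⟩
  have h1 := hω.1
  rw [mul_comm (R * φ), ← lt_div_iff₀ hRφ] at h1
  have h2 : (∑ t ∈ Finset.Icc 1 T, w t * ξ t ω (z t ω)) / (R * φ) =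
      ∑ t ∈ Finset.Icc 1 T, (w t / (R * φ)) * ξ t ω (z t ω) := by
    rw [Finset.sum_div]
    exact Finset.sum_congr rfl fun t _ => by ring
  rw [h2] at h1
  refine lt_of_le_of_lt ?_ h1
  rw [Finset.sum_const_zero, ← Finset.mul_sum, ← ha, ← hl]
  have h3 : l / M * a ≤ M := by
    rw [div_mul_eq_mul_div, div_le_iff₀ hM0, ← Real.mul_self_sqrt (mul_nonneg hl0 ha0)]
    have : √(l * a) ≤ M := by rw [hM]; linarith
    exact mul_le_mul this this (Real.sqrt_nonneg _) hM0.le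
  have h4 := mul_le_mul_of_nonneg_left h3 (Real.exp_pos p).le
  linarith

/-- The tail of the sum of the squared noise norms, whose terms have a conditional `p / 2`-th moment.
Their means need not be subtracted, because they sum to at most a multiple of `∑ w t ^ 2`. -/
theorem IsPolyNoise.measure_sum_sq_gt_le (h : IsPolyNoise μ ξ p φ) (hp : 4 < p) (hφ : 0 < φ)
    (hw : ∀ t, 1 ≤ t → 0 < w t) (hw1 : ∀ t, 1 ≤ t → w t ≤ 1) (hL : 1 ≤ L) (hδ : 0 < δ)
    (hδ1 : δ < 1) {T : ℕ} (hLb : L ^ p = 3 * (∑ t ∈ Finset.Icc 1 T, w t ^ p) / δ) :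
    μ {ω | (2 * Real.exp p + 3) *
          (Real.log (Real.exp 1 / δ) * ∑ t ∈ Finset.Icc 1 T, w t ^ 2 + L ^ 2) <
        ∑ t ∈ Finset.Icc 1 T, w t ^ 2 * (‖ξ t ω‖ / φ) ^ 2 ∧
        ∀ t ∈ Finset.Icc 1 T, w t * (‖ξ t ω‖ / φ) ≤ L} ≤ ENNReal.ofReal (δ / 3) := by
  have : ProperSpace (StrongDual ℝ E) := FiniteDimensional.proper ℝ _
  set l := Real.log (Real.exp 1 / δ) with hl
  set a := ∑ t ∈ Finset.Icc 1 T, w t ^ 2 with ha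
  have hl1 : 1 ≤ l := by
    rw [hl, Real.log_div (Real.exp_ne_zero 1) hδ.ne', Real.log_exp]
    linarith [Real.log_neg hδ hδ1]
  have ha0 : 0 ≤ a := Finset.sum_nonneg fun t _ => sq_nonneg _
  have hL0 : 0 < L := by linarith
  have hξm := fun t (ht : 1 ≤ t) => measurable_noiseSigma ξ ht
  have hle := h.noiseSigma_le
  have hθ : ∀ t ω, 0 ≤ ‖ξ t ω‖ / φ := fun t ω => by positivity
  have hYm : ∀ t, 1 ≤ t → Measurable[noiseSigma ξ t]
      (fun ω => w t ^ 2 * (‖ξ t ω‖ / φ) ^ 2) := fun t ht =>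
    (((measurable_norm.comp (hξm t ht)).div_const φ).pow_const 2).const_mul _
  have hYm' := fun t ht => (hYm t ht).mono (hle t) le_rfl
  have hY0 : ∀ t ω, 0 ≤ w t ^ 2 * (‖ξ t ω‖ / φ) ^ 2 := fun t ω => by positivity
  have hY1 : ∀ t, 1 ≤ t → ∀ ω,
      |w t ^ 2 * (‖ξ t ω‖ / φ) ^ 2| ≤ w t ^ 2 * (1 + (‖ξ t ω‖ / φ) ^ p) := fun t ht ω => by
    rw [abs_of_nonneg (hY0 t ω)]
    gcongr
    exact pow_le_one_add_rpow (hθ t ω) (by push_cast; linarith)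
  have hY2 : ∀ t, 1 ≤ t → ∀ ω, |(w t ^ 2 * (‖ξ t ω‖ / φ) ^ 2) ^ 2| ≤
      w t ^ 2 * (1 + (‖ξ t ω‖ / φ) ^ p) := fun t ht ω => by
    rw [abs_of_nonneg (sq_nonneg _), mul_pow, ← pow_mul, ← pow_mul]
    refine mul_le_mul (pow_le_pow_of_le_one (hw t ht).le (hw1 t ht) (by norm_num))
      (pow_le_one_add_rpow (hθ t ω) (by push_cast; linarith)) (by positivity) (sq_nonneg _)
  have hYq : ∀ t, 1 ≤ t → (fun ω => (w t ^ 2 * (‖ξ t ω‖ / φ) ^ 2) ^ (p / 2)) =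
      fun ω => w t ^ p * (‖ξ t ω‖ / φ) ^ p := fun t ht => funext fun ω => by
    rw [← mul_pow, ← Real.rpow_natCast, ← Real.rpow_mul (mul_nonneg (hw t ht).le (hθ t ω)),
      ← Real.mul_rpow (hw t ht).le (hθ t ω)]
    congr 1
    push_cast
    ring
  have hLb' : (L ^ 2) ^ (p / 2) = 3 * (∑ t ∈ Finset.Icc 1 T, w t ^ p) / δ := by
    rw [← hLb, ← Real.rpow_natCast, ← Real.rpow_mul hL0.le]
    congr 1
    push_cast
    ring
  have hmain := measure_lt_sum_and_forall_le_of_rpow_eq (μ := μ) (noiseSigma_mono ξ) hle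
    (m := fun t => 2 * w t ^ 2) (a := fun t => 2 * w t ^ 2) (b := fun t => w t ^ p) (q := p / 2)
    (L := L ^ 2) (M := L ^ 2) (by linarith) (by positivity) le_rfl hδ hδ1
    hYm hYm (fun t _ ω => (abs_of_nonneg (hY0 t ω)).le)
    (fun t ht => h.integrable_of_le ht (hYm' t ht) (hY1 t ht))
    (fun t ht => h.integrable_of_le ht ((hYm' t ht).pow_const 2) (hY2 t ht))
    (fun t ht => by rw [hYq t ht]; exact (h.integrable t ht).const_mul _)
    (fun t ht => h.condExp_le_two_mul ht (sq_nonneg _) (hYm' t ht) (hY1 t ht))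
    (fun t ht => h.condExp_le_two_mul ht (sq_nonneg _) ((hYm' t ht).pow_const 2) (hY2 t ht))
    (fun t ht => by
      rw [hYq t ht]
      exact h.condExp_const_mul_rpow_le ht (Real.rpow_nonneg (hw t ht).le p)) T hLb'
  refine (measure_mono ?_).trans hmain
  intro ω hω
  refine ⟨lt_of_le_of_lt ?_ hω.1, fun t ht => ?_⟩
  · rw [← Finset.mul_sum, ← ha, ← hl]
    have h1 : l / L ^ 2 ≤ l := div_le_self (by linarith) (one_le_pow₀ hL)
    have h2 : Real.exp (p / 2) ≤ Real.exp p := Real.exp_le_exp.2 (by linarith)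
    have h3 : Real.exp (p / 2) * (l / L ^ 2) * (2 * a) ≤ Real.exp p * l * (2 * a) := by gcongr
    have h4 : a ≤ l * a := le_mul_of_one_le_left ha0 hl1
    nlinarith [mul_nonneg (Real.exp_pos p).le (sq_nonneg L)]
  · rw [← mul_pow]
    exact pow_le_pow_left₀ (mul_nonneg (hw t (Finset.mem_Icc.1 ht).1).le (hθ t ω)) (hω.2 t ht) 2

end NoiseSums

/-! ### The stopped displacement and the stopping radius -/

section StoppedIterates

variable {E : Type u} [NormedAddCommGroup E] {Ω : Type v} {x : ℕ → Ω → E} {xstar : E}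

open Classical in
/-- The displacement `x t - xstar`, replaced by `0` from the first time on at which its norm
exceeds `R`. -/
noncomputable def stoppedDisplacement (x : ℕ → Ω → E) (xstar : E) (R : ℝ) (t : ℕ) (ω : Ω) : E :=
  if ∀ s ∈ Finset.Icc 1 t, ‖x s ω - xstar‖ ≤ R then x t ω - xstar else 0

theorem norm_stoppedDisplacement_le {R : ℝ} (hR : 0 ≤ R) {t : ℕ} (ht : 1 ≤ t) (ω : Ω) :
    ‖stoppedDisplacement x xstar R t ω‖ ≤ R := by
  unfold stoppedDisplacement
  split_ifs with hs
  · exact hs t (Finset.mem_Icc.2 ⟨ht, le_rfl⟩)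
  · simpa using hR

/-- The constant of the weighted regret bound. -/
noncomputable def regretConst (p : ℝ) : ℝ :=
  12 * (1 + (2 * Real.exp p + 3) + 2 * (2 * Real.exp p + 3) ^ 2)

theorem regretConst_pos (p : ℝ) : 0 < regretConst p := by
  unfold regretConst; positivity

/-- The squared radius at which the iterates are stopped is at most the claimed regret bound. -/
theorem stopping_radius_le {B η G φ l a p L β M : ℝ} (hB : 0 ≤ B) (hl : 0 ≤ l) (ha : 0 ≤ a)
    (hβ : 0 ≤ β) (hL : L ^ 2 ≤ 3 * β) (hM : M = L + √(l * a)) :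
    4 * (B + η ^ 2 * (G ^ 2 * a + φ ^ 2 * ((2 * Real.exp p + 3) * (l * a + L ^ 2)))
      + η ^ 2 * φ ^ 2 * ((2 * Real.exp p + 3) * M) ^ 2) ≤
    regretConst p * (B + η ^ 2 * (G ^ 2 * a + φ ^ 2 * (l * a + β))) := by
  set c := 2 * Real.exp p + 3 with hc
  have hc0 : 0 < c := by positivity
  set N := l * a + L ^ 2 with hN
  have hla : 0 ≤ l * a := mul_nonneg hl ha
  have hN3 : N ≤ 3 * (l * a + β) := by rw [hN]; linarith
  have hM2 : M ^ 2 ≤ 2 * N := by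
    have h1 : √(l * a) ^ 2 = l * a := Real.sq_sqrt hla
    rw [hM, hN]
    nlinarith [sq_nonneg (L - √(l * a))]
  have h1 : c * N + (c * M) ^ 2 ≤ (c + 2 * c ^ 2) * (3 * (l * a + β)) := by
    calc c * N + (c * M) ^ 2 = c * N + c ^ 2 * M ^ 2 := by ring
      _ ≤ c * N + c ^ 2 * (2 * N) := by gcongr
      _ = (c + 2 * c ^ 2) * N := by ring
      _ ≤ _ := by gcongr
  have h2 := mul_le_mul_of_nonneg_left h1 (by positivity : 0 ≤ η ^ 2 * φ ^ 2)
  have h3 : 0 ≤ η ^ 2 * (G ^ 2 * a) := by positivity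
  have h4 : 0 ≤ η ^ 2 * φ ^ 2 * (l * a + β) := by positivity
  have h5 : 0 ≤ c + 2 * c ^ 2 := by positivity
  have h6 := mul_nonneg h5 hB
  have h7 := mul_nonneg h5 h3
  have h8 : regretConst p = 12 * (1 + (c + 2 * c ^ 2)) := by
    rw [hc]; unfold regretConst; ring
  rw [h8]
  nlinarith

end StoppedIterates

/-! ### The regret bound for weighted step sizes -/

section HighProbability

variable {E : Type u} [NormedAddCommGroup E] [NormedSpace ℝ E] [FiniteDimensional ℝ E]
  {Ω : Type v} {m₀ : MeasurableSpace Ω} {μ : Measure Ω} [IsProbabilityMeasure μ]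
  {X dom : Set E} {ψ f : E → ℝ} {x₁ xstar : E}
  {g ξ : ℕ → Ω → StrongDual ℝ E} {x : ℕ → Ω → E} {p G φ δ η : ℝ} {w : ℕ → ℝ}

/-- The recursion for the Bregman divergences to `xstar` along the iterates. -/
theorem IsMirrorDescent.bregman_succ_le
    (h : IsMirrorDescent X dom ψ f (fun t => η * w t) x₁ g ξ x)
    (hf : ConvexOn ℝ X f) (hxs : xstar ∈ X) (hψ : IsRegularizer X dom ψ)
    (hG : ∀ t, 1 ≤ t → ∀ ω, ‖g t ω‖ ≤ G) (hφ : 0 < φ) (hη : 0 < η)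
    (hw : ∀ t, 1 ≤ t → 0 < w t) {t : ℕ} (ht : 1 ≤ t) (ω : Ω) :
    bregman ψ xstar (x (t + 1) ω) ≤
      bregman ψ xstar (x t ω) - η * w t * (f (x t ω) - f xstar)
        + η * (w t * ξ t ω (x t ω - xstar))
        + η ^ 2 * (w t ^ 2 * (G ^ 2 + φ ^ 2 * (‖ξ t ω‖ / φ) ^ 2)) := by
  have hstep : ∀ t, 1 ≤ t → 0 < η * w t := fun t ht => mul_pos hη (hw t ht)
  have h1 := h.mem hψ hf.1 hstep ht ω
  have h2 := h.mem hψ hf.1 hstep (Nat.le_add_left 1 t) ω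
  have h3 := hψ.bregman_step_le hf.1 h1.2 h2.1 h2.2 hxs (hstep t ht) (h.update_min t ht ω)
  have h4 := (h.subgradient t ht ω).2 xstar hxs
  have h5 : g t ω (xstar - x t ω) = -g t ω (x t ω - xstar) := by
    rw [← map_neg, neg_sub]
  rw [_root_.sub_apply] at h3
  have h6 : ‖g t ω - ξ t ω‖ ^ 2 ≤ 2 * (G ^ 2 + φ ^ 2 * (‖ξ t ω‖ / φ) ^ 2) := by
    have h7 : φ ^ 2 * (‖ξ t ω‖ / φ) ^ 2 = ‖ξ t ω‖ ^ 2 := by field_simp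
    rw [h7]
    have h8 : ‖g t ω - ξ t ω‖ ≤ G + ‖ξ t ω‖ :=
      (norm_sub_le _ _).trans (add_le_add_left (hG t ht ω) _)
    have h9 := pow_le_pow_left₀ (norm_nonneg _) h8 2
    nlinarith [sq_nonneg (G - ‖ξ t ω‖)]
  have h7 := mul_le_mul_of_nonneg_left h6 (by positivity : 0 ≤ (η * w t) ^ 2 / 2)
  have h8 : η * w t * (f (x t ω) - f xstar) ≤ η * w t * g t ω (x t ω - xstar) :=
    mul_le_mul_of_nonneg_left (by linarith) (hstep t ht).le
  nlinarith

theorem IsMirrorDescent.measurable_stoppedDisplacement [MeasurableSpace E] [BorelSpace E]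
    {step : ℕ → ℝ} (h : IsMirrorDescent X dom ψ f step x₁ g ξ x) (hψ : IsRegularizer X dom ψ)
    (hX : Convex ℝ X) (hstep : ∀ t, 1 ≤ t → 0 < step t)
    (hg : ∀ t, 1 ≤ t → Measurable[noiseSigma ξ t] (g t)) {R : ℝ} {t : ℕ} (ht : 1 ≤ t) :
    Measurable[noiseSigma ξ (t - 1)] (stoppedDisplacement x xstar R t) := by
  have : ProperSpace E := FiniteDimensional.proper ℝ E
  have hxm : ∀ s ∈ Finset.Icc 1 t, Measurable[noiseSigma ξ (t - 1)] (fun ω => x s ω - xstar) :=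
    fun s hs => by
      have h1 := h.measurable hψ hX hstep hg (Finset.mem_Icc.1 hs).1
      exact (h1.mono (noiseSigma_mono ξ (Nat.sub_le_sub_right (Finset.mem_Icc.1 hs).2 1))
        le_rfl).sub_const xstar
  refine Measurable.ite ?_ (hxm t (Finset.mem_Icc.2 ⟨ht, le_rfl⟩)) measurable_const
  have e : {ω | ∀ s ∈ Finset.Icc 1 t, ‖x s ω - xstar‖ ≤ R} =
      ⋂ s ∈ Finset.Icc 1 t, {ω | ‖x s ω - xstar‖ ≤ R} := by ext; simp
  rw [e]
  exact Finset.measurableSet_biInter _ fun s hs =>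
    (measurable_norm.comp (hxm s hs)) measurableSet_Iic

/-- The regret bound for the step sizes `η * w t` with weights `w t ≤ 1`. -/
theorem IsMirrorDescent.measure_sum_regret_gt_le
    (h : IsMirrorDescent X dom ψ f (fun t => η * w t) x₁ g ξ x) (hp : 4 < p)
    (hf : ConvexOn ℝ X f) (hxs : xstar ∈ X) (hmin : IsMinOn f X xstar)
    (hψ : IsRegularizer X dom ψ) (hG0 : 0 < G)
    (hG : ∀ t, 1 ≤ t → ∀ ω, ‖g t ω‖ ≤ G)
    (hgm : ∀ t, 1 ≤ t → Measurable[noiseSigma ξ t] (g t)) (hφ : 0 < φ)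
    (hξ : IsPolyNoise μ ξ p φ) (hδ : 0 < δ) (hδ1 : δ < 1) (hη : 0 < η)
    (hw : ∀ t, 1 ≤ t → 0 < w t) (hw1 : ∀ t, 1 ≤ t → w t ≤ 1) {T : ℕ}
    (hb : 1 ≤ ∑ t ∈ Finset.Icc 1 T, w t ^ p) :
    μ {ω | ¬ (∑ t ∈ Finset.Icc 1 T, η * w t * (f (x t ω) - f xstar) ≤
      regretConst p * (bregman ψ xstar x₁ + η ^ 2 * (G ^ 2 * ∑ t ∈ Finset.Icc 1 T, w t ^ 2
        + φ ^ 2 * (Real.log (Real.exp 1 / δ) * ∑ t ∈ Finset.Icc 1 T, w t ^ 2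
          + ((∑ t ∈ Finset.Icc 1 T, w t ^ p) / δ) ^ (2 / p)))))} ≤ ENNReal.ofReal δ := by
  classical
  let _ : MeasurableSpace E := borel E
  have : BorelSpace E := ⟨rfl⟩
  have : ProperSpace E := FiniteDimensional.proper ℝ E
  have hstep : ∀ t, 1 ≤ t → 0 < η * w t := fun t ht => mul_pos hη (hw t ht)
  set l := Real.log (Real.exp 1 / δ) with hl
  set a := ∑ t ∈ Finset.Icc 1 T, w t ^ 2 with ha
  set b := ∑ t ∈ Finset.Icc 1 T, w t ^ p with hb'
  set c := 2 * Real.exp p + 3 with hc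
  have hc0 : 0 < c := by positivity
  have hp0 : 0 < p := by linarith
  have hl1 : 1 ≤ l := by
    rw [hl, Real.log_div (Real.exp_ne_zero 1) hδ.ne', Real.log_exp]
    linarith [Real.log_neg hδ hδ1]
  have ha0 : 0 < a := by
    refine Finset.sum_pos (fun t ht => pow_pos (hw t (Finset.mem_Icc.1 ht).1) 2) ?_
    by_contra hne
    rw [hb', Finset.not_nonempty_iff_eq_empty.1 hne, Finset.sum_empty] at hb
    linarith
  -- the truncation level, chosen so that the noise stays below it with probability `1 - δ / 3`
  set L := (3 * b / δ) ^ (1 / p) with hL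
  have hbδ : 1 ≤ b / δ := (one_le_div hδ).2 (by linarith)
  have h3b : 1 ≤ 3 * b / δ := by rw [mul_div_assoc]; linarith
  have hL1 : 1 ≤ L := Real.one_le_rpow h3b (by positivity)
  have hL0 : 0 < L := by linarith
  have hLp : L ^ p = 3 * b / δ := by
    rw [hL, ← Real.rpow_mul (by linarith), one_div_mul_cancel hp0.ne', Real.rpow_one]
  have hL2 : L ^ 2 ≤ 3 * (b / δ) ^ (2 / p) := by
    have h1 : L ^ 2 = 3 ^ (2 / p) * (b / δ) ^ (2 / p) := by
      rw [hL, ← Real.rpow_natCast, ← Real.rpow_mul (by linarith), mul_div_assoc,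
        ← Real.mul_rpow (by norm_num) (by linarith)]
      congr 1
      push_cast
      ring
    rw [h1]
    gcongr
    calc (3 : ℝ) ^ (2 / p) ≤ 3 ^ (1 : ℝ) :=
          Real.rpow_le_rpow_of_exponent_le (by norm_num) ((div_le_one hp0).2 (by linarith))
      _ = 3 := Real.rpow_one 3
  set N := l * a + L ^ 2 with hN
  set M := L + √(l * a) with hM
  have hB0 : 0 ≤ bregman ψ xstar x₁ :=
    (by positivity : 0 ≤ 1 / 2 * ‖xstar - x₁‖ ^ 2).trans
      (hψ.half_sq_norm_le_bregman (hψ.subset_dom hxs) h.start_mem.2)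
  set S := 4 * (bregman ψ xstar x₁ + η ^ 2 * (G ^ 2 * a + φ ^ 2 * (c * N))
    + η ^ 2 * φ ^ 2 * (c * M) ^ 2) with hS
  have hS0 : 0 < S := by positivity
  set R := √S with hR
  have hR0 : 0 < R := Real.sqrt_pos.2 hS0
  have hR2 : R ^ 2 = S := Real.sq_sqrt hS0.le
  have hSle : S ≤ regretConst p * (bregman ψ xstar x₁ + η ^ 2 * (G ^ 2 * a
      + φ ^ 2 * (l * a + (b / δ) ^ (2 / p)))) :=
    stopping_radius_le hB0 (by linarith) ha0.le (by positivity) hL2 hM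
  set S₁ := ⋃ t ∈ Finset.Icc 1 T, {ω | L < w t * (‖ξ t ω‖ / φ)} with hS₁
  have m₁ : μ S₁ ≤ ENNReal.ofReal (δ / 3) := by
    refine (measure_biUnion_finset_le _ _).trans ?_
    have h1 : ∀ t ∈ Finset.Icc 1 T, μ {ω | L < w t * (‖ξ t ω‖ / φ)} ≤
        ENNReal.ofReal (w t ^ p / L ^ p) := fun t ht =>
      hξ.measure_lt_mul_le hp0 hφ (Finset.mem_Icc.1 ht).1 (hw t (Finset.mem_Icc.1 ht).1).le hL0
    refine (Finset.sum_le_sum h1).trans ?_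
    rw [← ENNReal.ofReal_sum_of_nonneg fun t ht => div_nonneg
      (Real.rpow_nonneg (hw t (Finset.mem_Icc.1 ht).1).le p) (Real.rpow_nonneg hL0.le p),
      ← Finset.sum_div, ← hb', hLp]
    refine ENNReal.ofReal_le_ofReal (le_of_eq ?_)
    have : b ≠ 0 := by linarith
    field_simp
  have m₂ := hξ.measure_martingale_gt_le hp hφ hw hL0 hδ hδ1 hLp
    (z := stoppedDisplacement x xstar R)
    (fun t ht => h.measurable_stoppedDisplacement hψ hf.1 hstep hgm ht) hR0
    (fun t ht => norm_stoppedDisplacement_le hR0.le ht)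
  have m₃ := hξ.measure_sum_sq_gt_le hp hφ hw hw1 hL1 hδ hδ1 hLp
  rw [← hl, ← ha, ← hc] at m₂ m₃
  rw [← hM] at m₂
  rw [← hN] at m₃
  set S₂ := {ω | R * φ * (c * M) < ∑ t ∈ Finset.Icc 1 T,
    w t * ξ t ω (stoppedDisplacement x xstar R t ω) ∧
      ∀ t ∈ Finset.Icc 1 T, w t * (‖ξ t ω‖ / φ) ≤ L} with hS₂
  set S₃ := {ω | c * N < ∑ t ∈ Finset.Icc 1 T, w t ^ 2 * (‖ξ t ω‖ / φ) ^ 2 ∧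
      ∀ t ∈ Finset.Icc 1 T, w t * (‖ξ t ω‖ / φ) ≤ L} with hS₃
  have hsub : {ω | ¬ (∑ t ∈ Finset.Icc 1 T, η * w t * (f (x t ω) - f xstar) ≤
      regretConst p * (bregman ψ xstar x₁ + η ^ 2 * (G ^ 2 * a
        + φ ^ 2 * (l * a + (b / δ) ^ (2 / p)))))} ⊆ S₁ ∪ (S₂ ∪ S₃) := by
    intro ω hω
    by_contra hnot
    rw [Set.mem_union, Set.mem_union, not_or, not_or] at hnot
    obtain ⟨n₁, n₂, n₃⟩ := hnot
    have k₁ : ∀ t ∈ Finset.Icc 1 T, w t * (‖ξ t ω‖ / φ) ≤ L := fun t ht => by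
      by_contra hlt
      exact n₁ (Set.mem_biUnion ht (not_le.1 hlt))
    have k₂ : ∑ t ∈ Finset.Icc 1 T, w t * ξ t ω (stoppedDisplacement x xstar R t ω) ≤
        R * φ * (c * M) := by
      by_contra hlt
      exact n₂ ⟨not_le.1 hlt, k₁⟩
    have k₃ : ∑ t ∈ Finset.Icc 1 T, w t ^ 2 * (‖ξ t ω‖ / φ) ^ 2 ≤ c * N := by
      by_contra hlt
      exact n₃ ⟨not_le.1 hlt, k₁⟩
    refine hω ((sum_regret_le (B := fun t => bregman ψ xstar (x t ω))
      (D := fun t => ‖x t ω - xstar‖) (n := fun t => ξ t ω (x t ω - xstar))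
      (θ := fun t => ‖ξ t ω‖ / φ) (φ := φ) (G := G) (X₂ := c * M) hη hR0.le
      (fun t ht => (hw t ht).le)
      (fun t ht => sub_nonneg.2 (hmin (h.mem hψ hf.1 hstep ht ω).1))
      (fun t ht => ?_)
      (fun t ht => h.bregman_succ_le hf hxs hψ hG hφ hη hw ht ω) ?_ k₃ ?_).trans
        (hR2.le.trans hSle))
    · have := hψ.half_sq_norm_le_bregman (hψ.subset_dom hxs) (h.mem hψ hf.1 hstep ht ω).2
      rw [norm_sub_rev]
      linarith
    · refine le_of_eq_of_le (Finset.sum_congr rfl fun t ht => ?_) k₂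
      unfold stoppedDisplacement
      split_ifs with hs
      · rfl
      · rw [map_zero]
    · simp only [h.start]
      rw [hR2, hS]
  calc _ ≤ μ (S₁ ∪ (S₂ ∪ S₃)) := measure_mono hsub
    _ ≤ μ S₁ + (μ S₂ + μ S₃) :=
      (measure_union_le _ _).trans (add_le_add le_rfl (measure_union_le _ _))
    _ ≤ ENNReal.ofReal (δ / 3) + (ENNReal.ofReal (δ / 3) + ENNReal.ofReal (δ / 3)) :=
      add_le_add m₁ (add_le_add m₂ m₃)
    _ = ENNReal.ofReal δ := by
      rw [← ENNReal.ofReal_add (by positivity) (by positivity),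
        ← ENNReal.ofReal_add (by positivity) (by positivity)]
      congr 1
      ring

end HighProbability

/-! ### The averaged iterate -/

section AverageIterate

theorem ConvexOn.avgIterate_sub_le {E : Type u} [NormedAddCommGroup E] [NormedSpace ℝ E]
    {Ω : Type v} {X : Set E} {f : E → ℝ} {xstar : E} {x : ℕ → Ω → E}
    (hf : ConvexOn ℝ X f) {T : ℕ} (hT : 1 ≤ T) {ω : Ω}
    (hx : ∀ t, 1 ≤ t → x t ω ∈ X) :
    f (avgIterate x T ω) - f xstar ≤ 1 / T * ∑ t ∈ Finset.Icc 1 T, (f (x t ω) - f xstar) := by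
  have hT0 : (T : ℝ) ≠ 0 := by positivity
  have h1 := hf.map_sum_le (t := Finset.Icc 1 T) (w := fun _ => 1 / (T : ℝ))
    (p := fun t => x t ω) (fun _ _ => by positivity)
    (by rw [Finset.sum_const, Nat.card_Icc, Nat.add_sub_cancel, nsmul_eq_mul,
      mul_one_div_cancel hT0])
    (fun t ht => hx t (Finset.mem_Icc.1 ht).1)
  rw [← Finset.smul_sum] at h1
  simp only [smul_eq_mul] at h1
  rw [← Finset.mul_sum] at h1
  rw [Finset.sum_sub_distrib, Finset.sum_const, Nat.card_Icc, Nat.add_sub_cancel, nsmul_eq_mul,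
    mul_sub, ← mul_assoc, one_div_mul_cancel hT0, one_mul]
  exact sub_le_sub_right h1 _

/-! ### The weights `1 / √t` -/


theorem sum_one_div_le_log {T : ℕ} (hT : 1 ≤ T) :
    ∑ t ∈ Finset.Icc 1 T, 1 / (t : ℝ) ≤ Real.log (Real.exp 1 * T) := by
  have h1 := harmonic_le_one_add_log T
  rw [harmonic_eq_sum_Icc] at h1
  push_cast at h1
  rw [Real.log_mul (Real.exp_ne_zero 1) (by positivity), Real.log_exp]
  simpa only [one_div] using h1

theorem sum_one_div_sq_le_two (T : ℕ) : ∑ t ∈ Finset.Icc 1 T, 1 / (t : ℝ) ^ 2 ≤ 2 := by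
  have h : ∀ n : ℕ, ∑ t ∈ Finset.Icc 1 (n + 1), 1 / (t : ℝ) ^ 2 ≤ 2 - 1 / ((n : ℝ) + 1) :=
    fun n => by
      induction n with
      | zero => norm_num
      | succ n ih =>
        rw [Finset.sum_Icc_succ_top (by omega)]
        have h1 : 1 / (((n : ℝ) + 1 + 1) ^ 2) ≤ 1 / ((n : ℝ) + 1) - 1 / ((n : ℝ) + 1 + 1) := by
          rw [div_sub_div _ _ (by positivity) (by positivity),
            div_le_div_iff₀ (by positivity) (by positivity)]
          have : (0 : ℝ) ≤ n := n.cast_nonneg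
          nlinarith
        push_cast
        linarith
  rcases T with _ | n
  · simp
  · exact (h n).trans (by linarith [(by positivity : 0 < 1 / ((n : ℝ) + 1))])

theorem log_le_mul_rpow {p δ : ℝ} (hp : 4 < p) (hδ : 0 < δ) (hδ1 : δ < 1) :
    Real.log (Real.exp 1 / δ) ≤ (1 + p / 2) * (1 / δ) ^ (2 / p) := by
  have h0 : 0 < 1 / δ := by positivity
  have h1 : 1 ≤ (1 / δ) ^ (2 / p) :=
    Real.one_le_rpow ((one_le_div hδ).2 hδ1.le) (by positivity)
  have h2 : Real.log ((1 / δ) ^ (2 / p)) ≤ (1 / δ) ^ (2 / p) - 1 :=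
    Real.log_le_sub_one_of_pos (by positivity)
  rw [Real.log_rpow h0] at h2
  have h3 : Real.log (Real.exp 1 / δ) = 1 + Real.log (1 / δ) := by
    rw [Real.log_div (Real.exp_ne_zero 1) hδ.ne', Real.log_exp, one_div, Real.log_inv]
    ring
  have h4 : Real.log (1 / δ) = p / 2 * (2 / p * Real.log (1 / δ)) := by
    field_simp
  rw [h3, h4]
  nlinarith

end AverageIterate

/-! ### The two step-size schedules -/

theorem corollary2 (p : ℝ) (hp : 4 < p) :
    ∃ C : ℝ, 0 < C ∧
      ∀ (E : Type u) [NormedAddCommGroup E] [NormedSpace ℝ E] [FiniteDimensional ℝ E]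
        (Ω : Type v) [MeasurableSpace Ω] (μ : Measure Ω) [IsProbabilityMeasure μ]
        (X dom : Set E) (ψ f : E → ℝ) (x₁ xstar : E)
        (g ξ : ℕ → Ω → StrongDual ℝ E) (x : ℕ → Ω → E)
        (G φ δ η : ℝ) (T : ℕ),
        IsClosed X → ConvexOn ℝ X f → xstar ∈ X → IsMinOn f X xstar →
        IsRegularizer X dom ψ →
        0 < G → (∀ t, 1 ≤ t → ∀ ω, ‖g t ω‖ ≤ G) →
        (∀ t, 1 ≤ t → Measurable[noiseSigma ξ t] (g t)) →
        0 < φ → IsPolyNoise μ ξ p φ →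
        0 < δ → δ < 1 → 0 < η → 1 ≤ T →
        (IsMirrorDescent X dom ψ f (fun _ => η) x₁ g ξ x →
          μ {ω | ¬ (f (avgIterate x T ω) - f xstar ≤
            C / T * (bregman ψ xstar x₁ / η
              + η * (G ^ 2 + φ ^ 2 * Real.log (Real.exp 1 / δ)) * T
              + η * φ ^ 2 * (T / δ) ^ (2 / p)))} ≤ ENNReal.ofReal δ) ∧
        (IsMirrorDescent X dom ψ f (fun t => η / √(t : ℝ)) x₁ g ξ x →
          μ {ω | ¬ (f (avgIterate x T ω) - f xstar ≤
            C * Real.log (Real.exp 1 * T) / √(T : ℝ) * (bregman ψ xstar x₁ / η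
              + η * (G ^ 2 + φ ^ 2 * (1 / δ) ^ (2 / p))))} ≤ ENNReal.ofReal δ) := by
  have hK := regretConst_pos p
  refine ⟨regretConst p * (3 + p / 2), by positivity, ?_⟩
  intro E _ _ _ Ω _ μ _ X dom ψ f x₁ xstar g ξ x G φ δ η T _ hf hxs hmin hψ hG0 hG hgm hφ hξ hδ
    hδ1 hη hT
  have hT0 : (0 : ℝ) < T := by exact_mod_cast hT
  have hT1 : (1 : ℝ) ≤ T := by exact_mod_cast hT
  set K := regretConst p with hKdef
  have hKC : K ≤ K * (3 + p / 2) := le_mul_of_one_le_right hK.le (by linarith)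
  set l := Real.log (Real.exp 1 / δ) with hl
  have hl0 : 0 ≤ l := by
    rw [hl, Real.log_div (Real.exp_ne_zero 1) hδ.ne', Real.log_exp]
    linarith [Real.log_neg hδ hδ1]
  have hB0 : x₁ ∈ X ∩ interior dom → 0 ≤ bregman ψ xstar x₁ := fun hx₁ =>
    (by positivity : 0 ≤ 1 / 2 * ‖xstar - x₁‖ ^ 2).trans
      (hψ.half_sq_norm_le_bregman (hψ.subset_dom hxs) hx₁.2)
  refine ⟨fun h => ?_, fun h => ?_⟩
  · have h' : IsMirrorDescent X dom ψ f (fun t => η * (fun _ => (1 : ℝ)) t) x₁ g ξ x := by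
      simpa only [mul_one] using h
    have hreg := h'.measure_sum_regret_gt_le hp hf hxs hmin hψ hG0 hG hgm hφ hξ hδ hδ1 hη
      (fun _ _ => one_pos) (fun _ _ => le_rfl) (T := T) (by simpa using hT1)
    simp only [Real.one_rpow, one_pow, mul_one, Finset.sum_const, Nat.card_Icc,
      Nat.add_sub_cancel, nsmul_eq_mul] at hreg
    refine (measure_mono ?_).trans hreg
    intro ω hω hle
    refine hω ?_
    rw [← Finset.mul_sum] at hle
    refine (ConvexOn.avgIterate_sub_le hf hT fun t ht =>
      (h.mem hψ hf.1 (fun _ _ => hη) ht ω).1).trans ?_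
    have hB := hB0 h.start_mem
    set Q := bregman ψ xstar x₁ / η + η * (G ^ 2 + φ ^ 2 * l) * T
      + η * φ ^ 2 * (T / δ) ^ (2 / p) with hQ
    have hQ0 : 0 ≤ Q := by positivity
    have h1 : ∑ t ∈ Finset.Icc 1 T, (f (x t ω) - f xstar) ≤ K * Q := by
      refine le_of_mul_le_mul_left (hle.trans_eq ?_) hη
      rw [hQ]
      field_simp
      ring
    calc _ ≤ 1 / (T : ℝ) * (K * (3 + p / 2) * Q) := by
          gcongr
          exact h1.trans (mul_le_mul_of_nonneg_right hKC hQ0)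
      _ = _ := by ring
  · let w : ℕ → ℝ := fun t => 1 / √(t : ℝ)
    have hw : ∀ t : ℕ, 1 ≤ t → 0 < w t := fun t ht => by
      have : (0 : ℝ) < t := by exact_mod_cast ht
      simp only [w]; positivity
    have hw1 : ∀ t : ℕ, 1 ≤ t → w t ≤ 1 := fun t ht => by
      have h1 : (1 : ℝ) ≤ √(t : ℝ) := Real.one_le_sqrt.2 (by exact_mod_cast ht)
      simp only [w]
      rw [div_le_one (by linarith)]
      exact h1
    have hw2 : ∀ t : ℕ, w t ^ 2 = 1 / (t : ℝ) := fun t => by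
      simp only [w]
      rw [div_pow, one_pow, Real.sq_sqrt t.cast_nonneg]
    have h' : IsMirrorDescent X dom ψ f (fun t => η * w t) x₁ g ξ x := by
      simpa only [w, mul_one_div] using h
    have ha : ∑ t ∈ Finset.Icc 1 T, w t ^ 2 ≤ Real.log (Real.exp 1 * T) := by
      simp only [hw2]
      exact sum_one_div_le_log hT
    -- as `p > 4`, the terms are at most `1 / t ^ 2`
    have hb2 : ∑ t ∈ Finset.Icc 1 T, w t ^ p ≤ 2 := by
      refine (Finset.sum_le_sum fun t ht => ?_).trans (sum_one_div_sq_le_two T)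
      have ht := (Finset.mem_Icc.1 ht).1
      calc w t ^ p ≤ w t ^ (4 : ℝ) :=
            Real.rpow_le_rpow_of_exponent_ge (hw t ht) (hw1 t ht) hp.le
        _ = (w t ^ 2) ^ 2 := by rw [← pow_mul]; norm_cast
        _ = _ := by rw [hw2, div_pow, one_pow]
    have hb1 : 1 ≤ ∑ t ∈ Finset.Icc 1 T, w t ^ p := by
      have h1 : w 1 ^ p = 1 := by simp [w]
      rw [← h1]
      exact Finset.single_le_sum (f := fun t => w t ^ p)
        (fun t ht => Real.rpow_nonneg (hw t (Finset.mem_Icc.1 ht).1).le p)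
        (Finset.mem_Icc.2 ⟨le_rfl, hT⟩)
    refine (measure_mono ?_).trans (h'.measure_sum_regret_gt_le hp hf hxs hmin hψ hG0 hG hgm hφ
      hξ hδ hδ1 hη hw hw1 hb1)
    intro ω hω hle
    refine hω ?_
    have hmem := fun t (ht : 1 ≤ t) =>
      (h'.mem hψ hf.1 (fun t ht => mul_pos hη (hw t ht)) ht ω).1
    refine (ConvexOn.avgIterate_sub_le hf hT hmem).trans ?_
    have hB := hB0 h.start_mem
    rw [← hl, ← hKdef] at hle
    set a := ∑ t ∈ Finset.Icc 1 T, w t ^ 2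
    set b := ∑ t ∈ Finset.Icc 1 T, w t ^ p
    set Λ := Real.log (Real.exp 1 * T) with hΛ
    set r := (1 / δ) ^ (2 / p) with hr
    have hΛ1 : 1 ≤ Λ := by
      rw [hΛ, Real.log_mul (Real.exp_ne_zero 1) hT0.ne', Real.log_exp]
      linarith [Real.log_nonneg hT1]
    have hr0 : 0 < r := by positivity
    have hlr : l ≤ (1 + p / 2) * r := log_le_mul_rpow hp hδ hδ1
    have hbr : (b / δ) ^ (2 / p) ≤ 2 * r := by
      calc (b / δ) ^ (2 / p) ≤ (2 * (1 / δ)) ^ (2 / p) := by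
            refine Real.rpow_le_rpow (by positivity) ?_ (by positivity)
            rw [mul_one_div]
            gcongr
        _ = 2 ^ (2 / p) * r := Real.mul_rpow (by norm_num) (by positivity)
        _ ≤ 2 ^ (1 : ℝ) * r := by
            gcongr
            · norm_num
            · rw [div_le_one (by linarith)]; linarith
        _ = 2 * r := by rw [Real.rpow_one]
    set Q := bregman ψ xstar x₁ / η + η * (G ^ 2 + φ ^ 2 * r) with hQ
    have hweighted : ∑ t ∈ Finset.Icc 1 T, η * w t * (f (x t ω) - f xstar) ≤
        K * (3 + p / 2) * Λ * (η * Q) := by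
      refine hle.trans ?_
      have h1 : l * a + (b / δ) ^ (2 / p) ≤ (3 + p / 2) * Λ * r := by
        have h2 : l * a ≤ (1 + p / 2) * r * Λ :=
          mul_le_mul hlr ha (Finset.sum_nonneg fun t _ => sq_nonneg _) (by positivity)
        nlinarith
      have h3 : bregman ψ xstar x₁ ≤ (3 + p / 2) * Λ * bregman ψ xstar x₁ :=
        le_mul_of_one_le_left hB (one_le_mul_of_one_le_of_one_le (by linarith) hΛ1)
      have h4 : G ^ 2 * a ≤ (3 + p / 2) * Λ * G ^ 2 := by
        have : a ≤ (3 + p / 2) * Λ := ha.trans (le_mul_of_one_le_left (by linarith) (by linarith))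
        rw [mul_comm]
        gcongr
      have h5 : η * Q = bregman ψ xstar x₁ + η ^ 2 * (G ^ 2 + φ ^ 2 * r) := by
        rw [hQ]; field_simp
      calc _ ≤ K * ((3 + p / 2) * Λ * bregman ψ xstar x₁ + η ^ 2 * ((3 + p / 2) * Λ * G ^ 2
              + φ ^ 2 * ((3 + p / 2) * Λ * r))) := by gcongr
        _ = _ := by rw [h5]; ring
    have hsqrt : 0 < √(T : ℝ) := Real.sqrt_pos.2 hT0
    -- the weights decrease, so the unweighted sum costs a factor `√T / η`
    have hsum : η / √(T : ℝ) * ∑ t ∈ Finset.Icc 1 T, (f (x t ω) - f xstar) ≤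
        K * (3 + p / 2) * Λ * (η * Q) := by
      refine le_trans ?_ hweighted
      rw [Finset.mul_sum]
      refine Finset.sum_le_sum fun t ht => ?_
      have ht' := Finset.mem_Icc.1 ht
      have h0 : 0 ≤ f (x t ω) - f xstar := sub_nonneg.2 (hmin (hmem t ht'.1))
      refine mul_le_mul_of_nonneg_right ?_ h0
      have ht0 : (0 : ℝ) < t := by exact_mod_cast ht'.1
      simp only [w]
      rw [mul_one_div]
      gcongr
      exact ht'.2
    have h1 : ∑ t ∈ Finset.Icc 1 T, (f (x t ω) - f xstar) ≤
        √(T : ℝ) * (K * (3 + p / 2) * Λ * Q) := by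
      rw [div_mul_eq_mul_div, div_le_iff₀ hsqrt] at hsum
      refine le_of_mul_le_mul_left (hsum.trans_eq ?_) hη
      ring
    calc _ ≤ 1 / (T : ℝ) * (√(T : ℝ) * (K * (3 + p / 2) * Λ * Q)) := by gcongr
      _ = √(T : ℝ) / T * (K * (3 + p / 2) * Λ * Q) := by ring
      _ = _ := by rw [Real.sqrt_div_self']; ring
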